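/- Consider the double integrator with $dt=0.5$, \[x_{k+1}=Ax_k+Bu_k,\quad y_k=x_k+e(x_k),\quad A=\begin{bmatrix}1&dt\\0&1\end{bmatrix},\ B=\begin{bmatrix}0\\1\end{bmatrix},\ C=I,\] where $e:\mathbb R^2\to\mathbb R^2$ is an error function with $e(0)=0$. Norms of vectors are sup norms. A system response $\mathbf\Phi=\begin{bmatrix}\Phi_{xw}&\Phi_{xe}\\ \Phi_{uw}&\Phi_{ue}\end{bmatrix}$ is a strictly proper transfer matrix $\sum_{t\ge1}\Phi(t)z^{-t}$ (real coefficients) with \[\begin{bmatrix}zI-A&-B\end{bmatrix}\mathbf\Phi=\begin{bmatrix}I&0\end{bmatrix},\qquad \mathbf\Phi\begin{bmatrix}zI-A\\-C\end{bmatrix}=\begin{bmatrix}I\\0\end{bmatrix};\] it is achieved by the controller $u=Ky$ with $K=\Phi_{ue}-\Phi_{uw}\Phi_{xw}^{-1}\Phi_{xe}$. Let $\|\mathbf\Phi\|_{\mathcal H_2}^2=\sum_t\|\Phi(t)\|_F^2$ and $\|\Phi_{xe}\|=\max_i\sum_t\sum_j|\Phi_{xe}(t)_{ij}|$ (the $\ell_\infty\to\ell_\infty$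 induced norm). For $\alpha\in\mathbb R$ consider the problem of minimizing $\|\mathbf\Phi\|_{\mathcal H_2}$ over all system responses with $\|\mathbf\Phi\|_{\mathcal H_2}<\infty$ and $\|\Phi_{xe}\|\le\alpha$. Call the origin of the closed loop (plant and controller, no process noise) asymptotically stable if it is Lyapunov stable and locally attractive: for every $N$, if the initial plant state and the $N$ past measurements that set the controller's internal state (which is zero before them) are small enough, then the states $x_k$ and inputs $u_k$ stay arbitrarily small, and they tend to $0$. Proposition. The problem without the constraint $\|\Phi_{xe}\|\le\alpha$ has a solution $\bar{\mathbf\Phi}$, and $S:=1/\|\bar\Phi_{xe}\|$ satisfies $|S-0.276|<0.0005$. There exists an error function $e$ with $e(0)=0$ and slope globally bounded by $S$ about the origin, i.e. $\|e(x)\|\le S\|x\|$ for all $x$, such that for every $\alpha$ for which the constrained problem is feasible, this problem has a unique solution $\mathbf\Phi$, and the closed loop of the double integrator, the error function $e$ and the controller $K$ of $\mathbf\Phi$ is asymptotically stable at the origin if and only if $\alpha<1/S$. -/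

import Mathlib

open Filter Topology
open scoped ENNReal

/-- The four closed-loop responses from process disturbance `w` and measurement error `e` to
state `x` and input `u`. The value at `t` is the coefficient of `z⁻ᵗ` in the transfer matrix. -/
@[ext]
structure SystemResponse (n m l : ℕ) where
  xw : ℕ → Matrix (Fin n) (Fin n) ℝ
  xe : ℕ → Matrix (Fin n) (Fin l) ℝ
  uw : ℕ → Matrix (Fin m) (Fin n) ℝ
  ue : ℕ → Matrix (Fin m) (Fin l) ℝ

/-- The responses are strictly proper and satisfy the affine realizability constraints
`[zI - A, -B] Φ = [I, 0]` and `Φ [zI - A; -C] = [I; 0]`, read off coefficient by coefficient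
(the coefficient of `z⁻ᵏ` for every `k`). -/
structure SystemResponse.Realizable {n m l : ℕ} (A : Matrix (Fin n) (Fin n) ℝ)
    (B : Matrix (Fin n) (Fin m) ℝ) (C : Matrix (Fin l) (Fin n) ℝ)
    (Φ : SystemResponse n m l) : Prop where
  xw_zero : Φ.xw 0 = 0
  xe_zero : Φ.xe 0 = 0
  uw_zero : Φ.uw 0 = 0
  ue_zero : Φ.ue 0 = 0
  row_w : ∀ k, Φ.xw (k + 1) - A * Φ.xw k - B * Φ.uw k = if k = 0 then 1 else 0
  row_e : ∀ k, Φ.xe (k + 1) - A * Φ.xe k - B * Φ.ue k = 0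
  col_x : ∀ k, Φ.xw (k + 1) - Φ.xw k * A - Φ.xe k * C = if k = 0 then 1 else 0
  col_u : ∀ k, Φ.uw (k + 1) - Φ.uw k * A - Φ.ue k * C = 0

/-- Square of the Frobenius norm. -/
noncomputable def frobSq {a b : ℕ} (M : Matrix (Fin a) (Fin b) ℝ) : ℝ≥0∞ :=
  ∑ i, ∑ j, ENNReal.ofReal (M i j ^ 2)

/-- Square of the `H₂` norm of the block transfer matrix `[Φ_xw, Φ_xe; Φ_uw, Φ_ue]`
(identity weights). -/
noncomputable def SystemResponse.h2NormSq {n m l : ℕ} (Φ : SystemResponse n m l) : ℝ≥0∞ :=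
  ∑' t, (frobSq (Φ.xw t) + frobSq (Φ.xe t) + frobSq (Φ.uw t) + frobSq (Φ.ue t))

/-- The `L₁` norm of a system (its `ℓ∞ → ℓ∞` induced norm): the largest absolute row sum of its
impulse response. -/
noncomputable def l1SystemNorm {a b : ℕ} (F : ℕ → Matrix (Fin a) (Fin b) ℝ) : ℝ≥0∞ :=
  ⨆ i, ∑' t, ∑ j, ENNReal.ofReal |F t i j|

/-- Feasible points of the `H₂` problem subject to `‖Φ_xe‖ ≤ α`. The choice `α = ⊤` gives the
problem without the norm constraint. -/
structure IsFeasible {n m l : ℕ} (A : Matrix (Fin n) (Fin n) ℝ)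
    (B : Matrix (Fin n) (Fin m) ℝ) (C : Matrix (Fin l) (Fin n) ℝ) (α : ℝ≥0∞)
    (Φ : SystemResponse n m l) : Prop where
  realizable : Φ.Realizable A B C
  finite_cost : Φ.h2NormSq < ⊤
  norm_le : l1SystemNorm Φ.xe ≤ α

/-- `Φ` solves the `H₂` problem subject to `‖Φ_xe‖ ≤ α`. -/
def IsH2Optimal {n m l : ℕ} (A : Matrix (Fin n) (Fin n) ℝ)
    (B : Matrix (Fin n) (Fin m) ℝ) (C : Matrix (Fin l) (Fin n) ℝ) (α : ℝ≥0∞)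
    (Φ : SystemResponse n m l) : Prop :=
  IsFeasible A B C α Φ ∧ ∀ Ψ, IsFeasible A B C α Ψ → Φ.h2NormSq ≤ Ψ.h2NormSq

/-- `u = K y` for the controller `K = Φ_ue - Φ_uw Φ_xw⁻¹ Φ_xe`, acting on signals that start at
time `0`. The signal `β` is given by `z Φ_xw β = - Φ_xe y`, and `u = z Φ_uw β + Φ_ue y`. As the
leading coefficient of `z Φ_xw` is the identity for a realizable `Φ`, the first equation determines
`β` recursively from `y`. -/
def SystemResponse.IsControlOutput {n m l : ℕ} (Φ : SystemResponse n m l)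
    (y : ℕ → Fin l → ℝ) (u : ℕ → Fin m → ℝ) : Prop :=
  ∃ β : ℕ → Fin n → ℝ,
    (∀ k, ∑ t ∈ Finset.range (k + 1), (Φ.xw (t + 1)).mulVec (β (k - t)) =
      -∑ t ∈ Finset.range (k + 1), (Φ.xe t).mulVec (y (k - t))) ∧
    (∀ k, u k = ∑ t ∈ Finset.range (k + 1), (Φ.uw (t + 1)).mulVec (β (k - t)) +
      ∑ t ∈ Finset.range (k + 1), (Φ.ue t).mulVec (y (k - t)))

/-- Trajectories of the closed loop `x⁺ = A x + B u`, `y = C x + e(x)`, `u = K y`, without process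
noise. The loop is closed at time `N`, with plant state `ξ`. The internal state of the controller
at that time is the one created by the (arbitrary) past measurements `η 0, …, η (N - 1)`. -/
structure IsClosedLoopTrajectory {n m l : ℕ} (A : Matrix (Fin n) (Fin n) ℝ)
    (B : Matrix (Fin n) (Fin m) ℝ) (C : Matrix (Fin l) (Fin n) ℝ) (Φ : SystemResponse n m l)
    (e : (Fin n → ℝ) → Fin l → ℝ) (N : ℕ) (η : ℕ → Fin l → ℝ) (ξ : Fin n → ℝ)
    (x : ℕ → Fin n → ℝ) (y : ℕ → Fin l → ℝ) (u : ℕ → Fin m → ℝ) : Prop where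
  past : ∀ k, k < N → y k = η k
  init : x N = ξ
  dynamics : ∀ k, N ≤ k → x (k + 1) = A.mulVec (x k) + B.mulVec (u k)
  measurement : ∀ k, N ≤ k → y k = C.mulVec (x k) + e (x k)
  control : Φ.IsControlOutput y u

/-- Asymptotic stability of the origin for the closed loop of plant and controller: Lyapunov
stability and local attractivity, with respect to the initial state of the plant and the initial
internal state of the controller (every state the controller can be brought into by finitely many
past measurements). Both the plant state and the controller output are required to stay small and
to converge to zero. -/
def ClosedLoopAsymptoticallyStable {n m l : ℕ} (A : Matrix (Fin n) (Fin n) ℝ)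
    (B : Matrix (Fin n) (Fin m) ℝ) (C : Matrix (Fin l) (Fin n) ℝ) (Φ : SystemResponse n m l)
    (e : (Fin n → ℝ) → Fin l → ℝ) : Prop :=
  (∀ N : ℕ, ∀ ε : ℝ, 0 < ε → ∃ δ : ℝ, 0 < δ ∧ ∀ η ξ x y u, IsClosedLoopTrajectory A B C Φ e N η ξ x y u →
    (∀ k, k < N → ‖η k‖ < δ) → ‖ξ‖ < δ → ∀ k, N ≤ k → ‖x k‖ < ε ∧ ‖u k‖ < ε) ∧
  (∀ N : ℕ, ∃ δ : ℝ, 0 < δ ∧ ∀ η ξ x y u, IsClosedLoopTrajectory A B C Φ e N η ξ x y u →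
    (∀ k, k < N → ‖η k‖ < δ) → ‖ξ‖ < δ → Tendsto x atTop (𝓝 0) ∧ Tendsto u atTop (𝓝 0))

/-- `f` has slope globally bounded by `S` about `x₀`. Norms on `Fin a → ℝ` are sup norms. -/
def SlopeBoundedAbout {a b : ℕ} (S : ℝ) (f : (Fin a → ℝ) → Fin b → ℝ) (x₀ : Fin a → ℝ) : Prop :=
  ∀ x, ‖f x - f x₀‖ ≤ S * ‖x - x₀‖

/-- State matrix of the double integrator with time step `dt`. -/
noncomputable def doubleIntegratorA (dt : ℝ) : Matrix (Fin 2) (Fin 2) ℝ := !![1, dt; 0, 1]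

/-- Input matrix of the double integrator. -/
noncomputable def doubleIntegratorB : Matrix (Fin 2) (Fin 1) ℝ := !![0; 1]

/-! The unconstrained optimum is the LQG controller: a state feedback and an observer, each given by
a Riccati equation. Its position response to the two measurement errors never takes positive values,
and the position row has a larger absolute sum than the velocity row. Hence `‖Φ_xe‖` equals `V`,
minus the static gain from the error direction `(1, 1)` to the position. With `S = 1 / V` and `e x =
-S * x 0 * (1, 1)`, the error feeds the position back along the worst-case direction with static
loop gain exactly one.

If `α < V`, every feasible response has gain product at most `α * S < 1`, and a small gain argument
gives stability (`closedLoop_asymptoticallyStable`). If `α ≥ V`, the LQG response is feasible for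
the constrained problem, so by uniqueness it is the solution. The position then obeys a renewal
equation whose kernel has mass one. A solution tending to zero would force the forcing term to have
zero sum (`renewal_sum_eq_zero`), which it has not (`not_asymptoticallyStable_of_static_gain`).

Existence and uniqueness come from projecting the origin onto a closed convex subset of `ℓ²`
(`exists_unique_isH2Optimal`). Optimality of the LQG response is orthogonality to all feasible
directions, whose inner products telescope by the Riccati equations
(`observerResponse_isH2Optimal`). The control Riccati equation has a rational solution; the filter
equation is solved over the field of a quartic root `d`. Signs and size of the LQG response follow
from numerical enclosures of finitely many terms and an invariant cone for the rest
(`nonneg_of_cone`, `doubleIntegratorResponse_gain`). -/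

/-- Index set of the scalar coefficients of a system response. -/
abbrev CoeffIndex (n m l : ℕ) : Type :=
  ℕ × (((Fin n × Fin n) ⊕ (Fin n × Fin l)) ⊕ ((Fin m × Fin n) ⊕ (Fin m × Fin l)))

/-! ### System responses as square-summable sequences. -/

namespace SystemResponse

variable {n m l : ℕ}

/-- All scalar coefficients of a system response, as one function. -/
def coeff (Φ : SystemResponse n m l) : CoeffIndex n m l → ℝ
  | (t, .inl (.inl p)) => Φ.xw t p.1 p.2
  | (t, .inl (.inr p)) => Φ.xe t p.1 p.2
  | (t, .inr (.inl p)) => Φ.uw t p.1 p.2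
  | (t, .inr (.inr p)) => Φ.ue t p.1 p.2

/-- The system response with given scalar coefficients. -/
def ofCoeff (v : CoeffIndex n m l → ℝ) : SystemResponse n m l where
  xw t := fun i j => v (t, .inl (.inl (i, j)))
  xe t := fun i j => v (t, .inl (.inr (i, j)))
  uw t := fun i j => v (t, .inr (.inl (i, j)))
  ue t := fun i j => v (t, .inr (.inr (i, j)))

@[simp] theorem coeff_ofCoeff (v : CoeffIndex n m l → ℝ) : (ofCoeff v).coeff = v := by
  funext ⟨t, p⟩
  rcases p with (p | p) | (p | p) <;> rfl

theorem h2NormSq_eq_tsum_coeff (Φ : SystemResponse n m l) :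
    Φ.h2NormSq = ∑' i, ENNReal.ofReal (Φ.coeff i ^ 2) := by
  rw [ENNReal.tsum_prod']
  simp only [h2NormSq, frobSq, tsum_fintype, Fintype.sum_sum_type, Fintype.sum_prod_type, coeff,
    add_assoc]

theorem summable_of_h2NormSq_lt_top {Φ : SystemResponse n m l} (h : Φ.h2NormSq < ⊤) :
    Summable fun i => Φ.coeff i ^ 2 := by
  rw [h2NormSq_eq_tsum_coeff] at h
  have := ENNReal.summable_toReal h.ne
  simpa [ENNReal.toReal_ofReal, sq_nonneg] using this

theorem h2NormSq_eq_ofReal_tsum {Φ : SystemResponse n m l}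
    (h : Summable fun i => Φ.coeff i ^ 2) :
    Φ.h2NormSq = ENNReal.ofReal (∑' i, Φ.coeff i ^ 2) := by
  rw [h2NormSq_eq_tsum_coeff, ENNReal.ofReal_tsum_of_nonneg (fun _ => sq_nonneg _) h]

theorem memℓp_coeff {Φ : SystemResponse n m l} (h : Summable fun i => Φ.coeff i ^ 2) :
    Memℓp (E := fun _ : CoeffIndex n m l => ℝ) Φ.coeff 2 := by
  rw [memℓp_gen_iff (by norm_num)]
  simpa using h

theorem summable_coeff_lp (v : lp (fun _ : CoeffIndex n m l => ℝ) 2) :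
    Summable fun i => (ofCoeff (v : CoeffIndex n m l → ℝ)).coeff i ^ 2 := by
  have := (memℓp_gen_iff (E := fun _ : CoeffIndex n m l => ℝ) (p := 2) (by norm_num)).1 (lp.memℓp v)
  simpa using this

theorem h2NormSq_lp (v : lp (fun _ : CoeffIndex n m l => ℝ) 2) :
    (ofCoeff (v : CoeffIndex n m l → ℝ)).h2NormSq = ENNReal.ofReal (‖v‖ ^ 2) := by
  rw [h2NormSq_eq_ofReal_tsum (summable_coeff_lp v)]
  congr 1
  have := lp.norm_rpow_eq_tsum (p := 2) (by norm_num) v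
  simp at this
  simp [this]

end SystemResponse

/-! ### The constrained problem as a projection in a Hilbert space. -/

section Convexity

variable {n m l : ℕ} {A : Matrix (Fin n) (Fin n) ℝ} {B : Matrix (Fin n) (Fin m) ℝ}
  {C : Matrix (Fin l) (Fin n) ℝ} {α : ℝ≥0∞}

/-- Each condition on the right involves finitely many coefficients, so it is closed in `ℓ²`,
although the `L₁` norm is not continuous there. -/
theorem l1SystemNorm_le_iff {a b : ℕ} {F : ℕ → Matrix (Fin a) (Fin b) ℝ} :
    l1SystemNorm F ≤ α ↔
      ∀ i T, ∑ t ∈ Finset.range T, ∑ j, ENNReal.ofReal |F t i j| ≤ α := by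
  rw [l1SystemNorm, iSup_le_iff]
  refine forall_congr' fun i => ⟨fun h T => (ENNReal.sum_le_tsum _).trans h, fun h => ?_⟩
  exact ENNReal.tsum_le_of_sum_range_le h

theorem l1SystemNorm_convex {a b : ℕ} {F G : ℕ → Matrix (Fin a) (Fin b) ℝ}
    (hF : l1SystemNorm F ≤ α) (hG : l1SystemNorm G ≤ α) {p q : ℝ} (hp : 0 ≤ p) (hq : 0 ≤ q)
    (hpq : p + q = 1) : l1SystemNorm (fun t => p • F t + q • G t) ≤ α := by
  rw [l1SystemNorm_le_iff] at *
  intro i T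
  calc ∑ t ∈ Finset.range T, ∑ j, ENNReal.ofReal |(p • F t + q • G t) i j|
      ≤ ∑ t ∈ Finset.range T, ∑ j, (ENNReal.ofReal p * ENNReal.ofReal |F t i j| +
          ENNReal.ofReal q * ENNReal.ofReal |G t i j|) := by
        refine Finset.sum_le_sum fun t _ => Finset.sum_le_sum fun j _ => ?_
        rw [← ENNReal.ofReal_mul hp, ← ENNReal.ofReal_mul hq,
          ← ENNReal.ofReal_add (by positivity) (by positivity)]
        apply ENNReal.ofReal_le_ofReal
        simp only [Matrix.add_apply, Matrix.smul_apply, smul_eq_mul]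
        refine (abs_add_le _ _).trans ?_
        rw [abs_mul, abs_mul, abs_of_nonneg hp, abs_of_nonneg hq]
    _ = ENNReal.ofReal p * ∑ t ∈ Finset.range T, ∑ j, ENNReal.ofReal |F t i j| +
          ENNReal.ofReal q * ∑ t ∈ Finset.range T, ∑ j, ENNReal.ofReal |G t i j| := by
        simp only [Finset.sum_add_distrib, Finset.mul_sum]
    _ ≤ ENNReal.ofReal p * α + ENNReal.ofReal q * α := by
        gcongr
        · exact hF i T
        · exact hG i T
    _ = α := by rw [← add_mul, ← ENNReal.ofReal_add hp hq, hpq]; simp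

theorem SystemResponse.Realizable.convex {Φ Ψ : SystemResponse n m l}
    (hΦ : Φ.Realizable A B C) (hΨ : Ψ.Realizable A B C) {p q : ℝ} (hpq : p + q = 1) :
    SystemResponse.Realizable A B C ⟨fun t => p • Φ.xw t + q • Ψ.xw t,
      fun t => p • Φ.xe t + q • Ψ.xe t, fun t => p • Φ.uw t + q • Ψ.uw t,
      fun t => p • Φ.ue t + q • Ψ.ue t⟩ := by
  have hone : ∀ (k : ℕ), (if k = 0 then (1 : Matrix (Fin n) (Fin n) ℝ) else 0) =
      p • (if k = 0 then 1 else 0) + q • (if k = 0 then 1 else 0) := by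
    intro k; rw [← add_smul, hpq, one_smul]
  constructor
  · simp [hΦ.xw_zero, hΨ.xw_zero]
  · simp [hΦ.xe_zero, hΨ.xe_zero]
  · simp [hΦ.uw_zero, hΨ.uw_zero]
  · simp [hΦ.ue_zero, hΨ.ue_zero]
  · intro k
    rw [hone k]
    nth_rewrite 1 [← hΦ.row_w k]
    rw [← hΨ.row_w k]
    simp only [mul_add, Matrix.mul_add, Matrix.mul_smul, smul_sub]
    abel
  · intro k
    have h : (0 : Matrix (Fin n) (Fin l) ℝ) = p • 0 + q • 0 := by simp
    rw [h]
    nth_rewrite 1 [← hΦ.row_e k]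
    rw [← hΨ.row_e k]
    simp only [Matrix.mul_add, Matrix.mul_smul, smul_sub]
    abel
  · intro k
    rw [hone k]
    nth_rewrite 1 [← hΦ.col_x k]
    rw [← hΨ.col_x k]
    simp only [add_mul, Matrix.add_mul, Matrix.smul_mul, smul_sub]
    abel
  · intro k
    have h : (0 : Matrix (Fin m) (Fin n) ℝ) = p • 0 + q • 0 := by simp
    rw [h]
    nth_rewrite 1 [← hΦ.col_u k]
    rw [← hΨ.col_u k]
    simp only [Matrix.add_mul, Matrix.smul_mul, smul_sub]
    abel

theorem SystemResponse.realizable_iff {Φ : SystemResponse n m l} :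
    Φ.Realizable A B C ↔ (Φ.xw 0 = 0 ∧ Φ.xe 0 = 0 ∧ Φ.uw 0 = 0 ∧ Φ.ue 0 = 0) ∧
      (∀ k, Φ.xw (k + 1) - A * Φ.xw k - B * Φ.uw k = if k = 0 then 1 else 0) ∧
      (∀ k, Φ.xe (k + 1) - A * Φ.xe k - B * Φ.ue k = 0) ∧
      (∀ k, Φ.xw (k + 1) - Φ.xw k * A - Φ.xe k * C = if k = 0 then 1 else 0) ∧
      (∀ k, Φ.uw (k + 1) - Φ.uw k * A - Φ.ue k * C = 0) :=
  ⟨fun h => ⟨⟨h.1, h.2, h.3, h.4⟩, h.5, h.6, h.7, h.8⟩,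
    fun ⟨⟨h1, h2, h3, h4⟩, h5, h6, h7, h8⟩ => ⟨h1, h2, h3, h4, h5, h6, h7, h8⟩⟩

/-- The feasible points of the constrained problem, as a subset of a Hilbert space. -/
def feasibleSet (A : Matrix (Fin n) (Fin n) ℝ) (B : Matrix (Fin n) (Fin m) ℝ)
    (C : Matrix (Fin l) (Fin n) ℝ) (α : ℝ≥0∞) : Set (lp (fun _ : CoeffIndex n m l => ℝ) 2) :=
  {v | (SystemResponse.ofCoeff (v : CoeffIndex n m l → ℝ)).Realizable A B C ∧
    l1SystemNorm (SystemResponse.ofCoeff (v : CoeffIndex n m l → ℝ)).xe ≤ α}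

theorem mem_feasibleSet_iff {v : lp (fun _ : CoeffIndex n m l => ℝ) 2} :
    v ∈ feasibleSet A B C α ↔
      IsFeasible A B C α (SystemResponse.ofCoeff (v : CoeffIndex n m l → ℝ)) := by
  refine ⟨fun h => ⟨h.1, ?_, h.2⟩, fun h => ⟨h.realizable, h.norm_le⟩⟩
  rw [SystemResponse.h2NormSq_lp]
  exact ENNReal.ofReal_lt_top

theorem convex_feasibleSet : Convex ℝ (feasibleSet A B C α) := by
  intro v hv w hw p q hp hq hpq
  exact ⟨hv.1.convex hw.1 hpq, l1SystemNorm_convex hv.2 hw.2 hp hq hpq⟩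

theorem isClosed_feasibleSet : IsClosed (feasibleSet A B C α) := by
  have hc : ∀ i : CoeffIndex n m l,
      Continuous fun v : lp (fun _ : CoeffIndex n m l => ℝ) 2 => (v : CoeffIndex n m l → ℝ) i :=
    fun i => (lp.evalCLM ℝ (fun _ : CoeffIndex n m l => ℝ) 2 i).continuous
  have hxw : ∀ t, Continuous fun v : lp (fun _ : CoeffIndex n m l => ℝ) 2 =>
      (SystemResponse.ofCoeff (v : CoeffIndex n m l → ℝ)).xw t :=
    fun t => continuous_matrix fun i j => hc _
  have hxe : ∀ t, Continuous fun v : lp (fun _ : CoeffIndex n m l => ℝ) 2 =>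
      (SystemResponse.ofCoeff (v : CoeffIndex n m l → ℝ)).xe t :=
    fun t => continuous_matrix fun i j => hc _
  have huw : ∀ t, Continuous fun v : lp (fun _ : CoeffIndex n m l => ℝ) 2 =>
      (SystemResponse.ofCoeff (v : CoeffIndex n m l → ℝ)).uw t :=
    fun t => continuous_matrix fun i j => hc _
  have hue : ∀ t, Continuous fun v : lp (fun _ : CoeffIndex n m l => ℝ) 2 =>
      (SystemResponse.ofCoeff (v : CoeffIndex n m l → ℝ)).ue t :=
    fun t => continuous_matrix fun i j => hc _
  apply IsClosed.inter
  · change IsClosed {v : lp (fun _ : CoeffIndex n m l => ℝ) 2 |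
        (SystemResponse.ofCoeff (v : CoeffIndex n m l → ℝ)).Realizable A B C}
    simp only [SystemResponse.realizable_iff, Set.ofPred_and, Set.ofPred_forall]
    refine (((isClosed_eq (hxw _) continuous_const).inter ((isClosed_eq (hxe _)
      continuous_const).inter ((isClosed_eq (huw _) continuous_const).inter
      (isClosed_eq (hue _) continuous_const))))).inter ?_
    refine IsClosed.inter (isClosed_iInter fun k => isClosed_eq ?_ continuous_const) ?_
    · exact ((hxw _).sub (continuous_const.matrix_mul (hxw k))).sub
        (continuous_const.matrix_mul (huw k))
    refine IsClosed.inter (isClosed_iInter fun k => isClosed_eq ?_ continuous_const) ?_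
    · exact ((hxe _).sub (continuous_const.matrix_mul (hxe k))).sub
        (continuous_const.matrix_mul (hue k))
    refine IsClosed.inter (isClosed_iInter fun k => isClosed_eq ?_ continuous_const) ?_
    · exact ((hxw _).sub ((hxw k).matrix_mul continuous_const)).sub
        ((hxe k).matrix_mul continuous_const)
    refine isClosed_iInter fun k => isClosed_eq ?_ continuous_const
    exact ((huw _).sub ((huw k).matrix_mul continuous_const)).sub
        ((hue k).matrix_mul continuous_const)
  · change IsClosed {v : lp (fun _ : CoeffIndex n m l => ℝ) 2 |
      l1SystemNorm (SystemResponse.ofCoeff (v : CoeffIndex n m l → ℝ)).xe ≤ α}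
    simp only [l1SystemNorm_le_iff, Set.ofPred_forall]
    refine isClosed_iInter fun i => isClosed_iInter fun T => isClosed_le ?_ continuous_const
    refine continuous_finsetSum _ fun t _ => continuous_finsetSum _ fun j _ => ?_
    exact ENNReal.continuous_ofReal.comp (hc _).abs

/-- A feasible `H₂` problem has exactly one solution. -/
theorem exists_unique_isH2Optimal (h : ∃ Φ, IsFeasible A B C α Φ) :
    ∃ Φ, IsH2Optimal A B C α Φ ∧ ∀ Ψ, IsH2Optimal A B C α Ψ → Ψ = Φ := by
  have lift : ∀ Φ : SystemResponse n m l, IsFeasible A B C α Φ →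
      ∃ v ∈ feasibleSet A B C α,
        SystemResponse.ofCoeff (v : CoeffIndex n m l → ℝ) = Φ := fun Φ hΦ =>
    ⟨⟨Φ.coeff, SystemResponse.memℓp_coeff
      (SystemResponse.summable_of_h2NormSq_lt_top hΦ.finite_cost)⟩,
      mem_feasibleSet_iff.2 hΦ, rfl⟩
  obtain ⟨Φ₀, hΦ₀⟩ := h
  obtain ⟨v₀, hv₀, -⟩ := lift Φ₀ hΦ₀
  obtain ⟨v, hv, hmin⟩ := exists_norm_eq_iInf_of_complete_convex ⟨v₀, hv₀⟩
    (isClosed_feasibleSet (A := A) (B := B) (C := C) (α := α)).isComplete convex_feasibleSet 0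
  have hle : ∀ w ∈ feasibleSet A B C α, ‖v‖ ≤ ‖w‖ := by
    intro w hw
    have h1 : (⨅ w : feasibleSet A B C α, ‖(0 : lp (fun _ : CoeffIndex n m l => ℝ) 2) - w‖) ≤
        ‖(0 : lp (fun _ : CoeffIndex n m l => ℝ) 2) - w‖ :=
      ciInf_le ⟨0, by rintro _ ⟨_, rfl⟩; exact norm_nonneg _⟩
        (⟨w, hw⟩ : feasibleSet A B C α)
    rw [← hmin] at h1
    simpa using h1
  refine ⟨SystemResponse.ofCoeff (v : CoeffIndex n m l → ℝ),
    ⟨mem_feasibleSet_iff.1 hv, fun Ψ hΨ => ?_⟩, fun Ψ hΨ => ?_⟩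
  · obtain ⟨w, hw, rfl⟩ := lift Ψ hΨ
    rw [SystemResponse.h2NormSq_lp, SystemResponse.h2NormSq_lp]
    have := hle w hw
    gcongr
  · obtain ⟨w, hw, rfl⟩ := lift Ψ hΨ.1
    have h1 := hΨ.2 _ (mem_feasibleSet_iff.1 hv)
    rw [SystemResponse.h2NormSq_lp, SystemResponse.h2NormSq_lp,
      ENNReal.ofReal_le_ofReal_iff (by positivity)] at h1
    -- The midpoint of two minimizers is feasible, hence no shorter than either; the parallelogram
    -- law then forces them to coincide.
    have h2 := hle _ (convex_feasibleSet hv hw (by norm_num : (0 : ℝ) ≤ 1 / 2)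
      (by norm_num : (0 : ℝ) ≤ 1 / 2) (by norm_num))
    rw [← smul_add, norm_smul, Real.norm_of_nonneg (by norm_num)] at h2
    have h3 := parallelogram_law_with_norm ℝ v w
    have h4 : ‖v - w‖ = 0 := by
      have : ‖v - w‖ * ‖v - w‖ ≤ 0 := by nlinarith [norm_nonneg v, norm_nonneg (v + w)]
      nlinarith [norm_nonneg (v - w)]
    rw [norm_eq_zero, sub_eq_zero] at h4
    rw [h4]

/-- A feasible point that is orthogonal to all feasible directions is optimal. -/
theorem isH2Optimal_of_orthogonal {Φ : SystemResponse n m l} (hΦ : IsFeasible A B C α Φ)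
    (h : ∀ Ψ, IsFeasible A B C α Ψ → ∀ s,
      HasSum (fun i => Φ.coeff i * (Ψ.coeff i - Φ.coeff i)) s → s = 0) :
    IsH2Optimal A B C α Φ := by
  refine ⟨hΦ, fun Ψ hΨ => ?_⟩
  have sΦ := SystemResponse.summable_of_h2NormSq_lt_top hΦ.finite_cost
  have sΨ := SystemResponse.summable_of_h2NormSq_lt_top hΨ.finite_cost
  have sm : Summable fun i => Φ.coeff i * (Ψ.coeff i - Φ.coeff i) := by
    refine Summable.of_norm_bounded (g := fun i => 2 * Φ.coeff i ^ 2 + Ψ.coeff i ^ 2)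
      ((sΦ.mul_left 2).add sΨ) fun i => ?_
    rw [Real.norm_eq_abs, abs_le]
    constructor <;>
      nlinarith [sq_nonneg (Φ.coeff i - Ψ.coeff i), sq_nonneg (Φ.coeff i + Ψ.coeff i),
        sq_nonneg (Φ.coeff i), sq_nonneg (Ψ.coeff i)]
  have h0 := h Ψ hΨ _ sm.hasSum
  rw [SystemResponse.h2NormSq_eq_ofReal_tsum sΦ, SystemResponse.h2NormSq_eq_ofReal_tsum sΨ]
  apply ENNReal.ofReal_le_ofReal
  have h1 : ∑' i, (Φ.coeff i ^ 2 + 2 * (Φ.coeff i * (Ψ.coeff i - Φ.coeff i))) =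
      ∑' i, Φ.coeff i ^ 2 := by
    rw [sΦ.tsum_add (sm.mul_left 2), tsum_mul_left, h0]; ring
  rw [← h1]
  -- Termwise this is `Φ² + 2Φ(Ψ - Φ) ≤ Ψ²`, that is `(Ψ - Φ)² ≥ 0`.
  refine (sΦ.add (sm.mul_left 2)).tsum_le_tsum (fun i => ?_) sΨ
  nlinarith [sq_nonneg (Ψ.coeff i - Φ.coeff i)]

end Convexity

/-! ### Causal convolutions and their gains. -/

/-- Response of the system with impulse response `F` to the signal `s` started at time `0`. -/
def causalConv {a b : ℕ} (F : ℕ → Matrix (Fin a) (Fin b) ℝ) (s : ℕ → Fin b → ℝ) (k : ℕ) :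
    Fin a → ℝ :=
  ∑ t ∈ Finset.range (k + 1), (F t).mulVec (s (k - t))

section Convolution

variable {a b c : ℕ} (F G : ℕ → Matrix (Fin a) (Fin b) ℝ) (s r : ℕ → Fin b → ℝ)

theorem causalConv_zero : causalConv F s 0 = (F 0).mulVec (s 0) := by
  simp [causalConv]

theorem causalConv_succ (k : ℕ) :
    causalConv F s (k + 1) = (F 0).mulVec (s (k + 1)) + causalConv (fun t => F (t + 1)) s k := by
  rw [causalConv, Finset.sum_range_succ', add_comm]
  simp [causalConv]

theorem causalConv_succ' (k : ℕ) :
    causalConv F s (k + 1) = (F (k + 1)).mulVec (s 0) + causalConv F (fun t => s (t + 1)) k := by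
  rw [causalConv, Finset.sum_range_succ, add_comm, Nat.sub_self, causalConv]
  congr 1
  refine Finset.sum_congr rfl fun t ht => ?_
  rw [Nat.sub_add_comm (Nat.lt_succ_iff.1 (Finset.mem_range.1 ht))]

theorem causalConv_add_signal (k : ℕ) :
    causalConv F (fun t => s t + r t) k = causalConv F s k + causalConv F r k := by
  simp [causalConv, Matrix.mulVec_add, Finset.sum_add_distrib]

theorem causalConv_sub_signal (k : ℕ) :
    causalConv F (fun t => s t - r t) k = causalConv F s k - causalConv F r k := by
  simp [causalConv, Matrix.mulVec_sub, Finset.sum_sub_distrib]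

theorem causalConv_add_left (k : ℕ) :
    causalConv (fun t => F t + G t) s k = causalConv F s k + causalConv G s k := by
  simp [causalConv, Matrix.add_mulVec, Finset.sum_add_distrib]

theorem causalConv_mul_left (M : Matrix (Fin c) (Fin a) ℝ) (k : ℕ) :
    causalConv (fun t => M * F t) s k = M.mulVec (causalConv F s k) := by
  simp [causalConv, Matrix.mulVec_sum]

theorem causalConv_mulVec (M : Matrix (Fin b) (Fin c) ℝ) (r : ℕ → Fin c → ℝ) (k : ℕ) :
    causalConv F (fun t => M.mulVec (r t)) k = causalConv (fun t => F t * M) r k := by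
  simp [causalConv]

theorem causalConv_eq_sum_reflect (k : ℕ) :
    causalConv F s k = ∑ j ∈ Finset.range (k + 1), (F (k - j)).mulVec (s j) := by
  rw [causalConv, ← Finset.sum_range_reflect]
  refine Finset.sum_congr rfl fun j hj => ?_
  have := Finset.mem_range.1 hj
  congr 2; omega

theorem exists_norm_mulVec_le (M : Matrix (Fin a) (Fin b) ℝ) :
    ∃ C, 0 ≤ C ∧ ∀ v, ‖M.mulVec v‖ ≤ C * ‖v‖ :=
  ⟨‖(Matrix.mulVecLin M).toContinuousLinearMap‖, norm_nonneg _,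
    fun v => (Matrix.mulVecLin M).toContinuousLinearMap.le_opNorm v⟩

theorem norm_mulVec_le_of_abs_le {M : Matrix (Fin a) (Fin b) ℝ} {C : ℝ} (hC : 0 ≤ C)
    (h : ∀ i j, |M i j| ≤ C) (v : Fin b → ℝ) : ‖M.mulVec v‖ ≤ b * C * ‖v‖ := by
  rw [pi_norm_le_iff_of_nonneg (by positivity)]
  intro i
  rw [Matrix.mulVec, dotProduct]
  calc ‖∑ j, M i j * v j‖ ≤ ∑ j, ‖M i j * v j‖ := norm_sum_le _ _
    _ ≤ ∑ _j : Fin b, C * ‖v‖ := by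
        refine Finset.sum_le_sum fun j _ => ?_
        rw [norm_mul]
        exact mul_le_mul (h i j) (norm_le_pi_norm v j) (norm_nonneg _) hC
    _ = b * C * ‖v‖ := by simp; ring

theorem exists_norm_causalConv_le (k : ℕ) :
    ∃ C, 0 ≤ C ∧ ∀ (s : ℕ → Fin b → ℝ) (M : ℝ), (∀ j ≤ k, ‖s j‖ ≤ M) →
      ‖causalConv F s k‖ ≤ C * M := by
  choose C hC h using fun t => exists_norm_mulVec_le (F t)
  refine ⟨∑ t ∈ Finset.range (k + 1), C t, Finset.sum_nonneg fun t _ => hC t, fun s M hs => ?_⟩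
  rw [causalConv, Finset.sum_mul]
  exact norm_sum_le_of_le _ fun t _ => (h t _).trans
    (mul_le_mul_of_nonneg_left (hs _ (Nat.sub_le _ _)) (hC t))

theorem causalConv_of_support {K : ℕ} (hs : ∀ j, K ≤ j → s j = 0) {k : ℕ} (hk : K ≤ k) :
    causalConv F s k = ∑ j ∈ Finset.range K, (F (k - j)).mulVec (s j) := by
  rw [causalConv_eq_sum_reflect]
  refine (Finset.sum_subset (Finset.range_mono (by omega)) fun j _ hj => ?_).symm
  rw [hs j (by simpa using hj), Matrix.mulVec_zero]

variable {F s}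

theorem norm_causalConv_le_of_support {C δ : ℝ} (hC : 0 ≤ C) (hF : ∀ t i j, |F t i j| ≤ C)
    {K : ℕ} (hs : ∀ j, K ≤ j → s j = 0) (hδ : ∀ j, ‖s j‖ ≤ δ) (k : ℕ) :
    ‖causalConv F s k‖ ≤ K * (b * C * δ) := by
  have hδ0 : 0 ≤ δ := (norm_nonneg _).trans (hδ 0)
  have hb : ∀ j t, ‖(F t).mulVec (s j)‖ ≤ b * C * δ := fun j t =>
    (norm_mulVec_le_of_abs_le hC (hF t) _).trans
      (mul_le_mul_of_nonneg_left (hδ j) (by positivity))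
  rcases le_total K k with hk | hk
  · rw [causalConv_of_support F s hs hk]
    refine (norm_sum_le_of_le _ fun j _ => hb j _).trans (le_of_eq ?_)
    simp
  · rcases hk.eq_or_lt with rfl | hk
    · rw [causalConv_of_support F s hs le_rfl]
      refine (norm_sum_le_of_le _ fun j _ => hb j _).trans (le_of_eq ?_)
      simp
    · rw [causalConv_eq_sum_reflect]
      refine (norm_sum_le_of_le _ fun j _ => hb j _).trans ?_
      simp only [Finset.sum_const, Finset.card_range, nsmul_eq_mul]
      refine mul_le_mul_of_nonneg_right ?_ (by positivity)
      exact_mod_cast hk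

theorem tendsto_causalConv_of_support (hF : ∀ i j, Tendsto (fun t => F t i j) atTop (𝓝 0))
    {K : ℕ} (hs : ∀ j, K ≤ j → s j = 0) : Tendsto (causalConv F s) atTop (𝓝 0) := by
  have h : Tendsto (fun k => ∑ j ∈ Finset.range K, (F (k - j)).mulVec (s j)) atTop
      (𝓝 (∑ j ∈ Finset.range K, (0 : Fin a → ℝ))) := by
    refine tendsto_finsetSum _ fun j _ => tendsto_pi_nhds.2 fun i => ?_
    have : Tendsto (fun k => ∑ q, F (k - j) i q * s j q) atTop (𝓝 (∑ q, (0 : ℝ) * s j q)) :=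
      tendsto_finsetSum _ fun q _ =>
        ((hF i q).comp (tendsto_sub_atTop_nat j)).mul_const _
    simpa [Matrix.mulVec, dotProduct] using this
  rw [Finset.sum_const_zero] at h
  refine h.congr' ?_
  filter_upwards [eventually_ge_atTop K] with k hk
  rw [causalConv_of_support F s hs hk]

theorem summable_of_l1SystemNorm_le {α : ℝ} (h : l1SystemNorm F ≤ ENNReal.ofReal α) (i : Fin a) :
    Summable fun t => ∑ j, |F t i j| := by
  have h1 : ∑' t, ENNReal.ofReal (∑ j, |F t i j|) ≠ ⊤ := by
    refine ne_top_of_le_ne_top ENNReal.ofReal_ne_top (le_trans ?_ h)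
    rw [l1SystemNorm]
    refine le_trans (le_of_eq ?_) (le_iSup _ i)
    congr 1; funext t
    rw [ENNReal.ofReal_sum_of_nonneg fun _ _ => abs_nonneg _]
  have := ENNReal.summable_toReal h1
  refine this.congr fun t => ?_
  rw [ENNReal.toReal_ofReal (Finset.sum_nonneg fun _ _ => abs_nonneg _)]

theorem sum_range_le_of_l1SystemNorm_le {α : ℝ} (hα : 0 ≤ α)
    (h : l1SystemNorm F ≤ ENNReal.ofReal α) (i : Fin a) (T : ℕ) :
    ∑ t ∈ Finset.range T, ∑ j, |F t i j| ≤ α := by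
  have h1 := l1SystemNorm_le_iff.1 h i T
  rw [← ENNReal.ofReal_le_ofReal_iff hα]
  refine le_trans (le_of_eq ?_) h1
  rw [ENNReal.ofReal_sum_of_nonneg fun _ _ => Finset.sum_nonneg fun _ _ => abs_nonneg _]
  refine Finset.sum_congr rfl fun t _ => ?_
  rw [ENNReal.ofReal_sum_of_nonneg fun _ _ => abs_nonneg _]

theorem tendsto_of_l1SystemNorm_le {α : ℝ} (h : l1SystemNorm F ≤ ENNReal.ofReal α)
    (i : Fin a) (j : Fin b) : Tendsto (fun t => F t i j) atTop (𝓝 0) := by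
  refine squeeze_zero_norm (fun t => ?_) (summable_of_l1SystemNorm_le h i).tendsto_atTop_zero
  exact Finset.single_le_sum (f := fun j => |F t i j|) (fun _ _ => abs_nonneg _)
    (Finset.mem_univ j)

/-- The `L₁` norm bounds the gain from `ℓ∞` to `ℓ∞`. -/
theorem norm_causalConv_le {α M : ℝ} (hα : 0 ≤ α) (h : l1SystemNorm F ≤ ENNReal.ofReal α)
    (hM : 0 ≤ M) (hF : F 0 = 0) {k : ℕ} (hs : ∀ j < k, ‖s j‖ ≤ M) :
    ‖causalConv F s k‖ ≤ α * M := by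
  rw [pi_norm_le_iff_of_nonneg (by positivity)]
  intro i
  simp only [causalConv, Finset.sum_apply, Matrix.mulVec, dotProduct]
  calc ‖∑ t ∈ Finset.range (k + 1), ∑ j, F t i j * s (k - t) j‖
      ≤ ∑ t ∈ Finset.range (k + 1), (∑ j, |F t i j|) * M := by
        refine norm_sum_le_of_le _ fun t ht => ?_
        rw [Finset.sum_mul]
        refine norm_sum_le_of_le _ fun j _ => ?_
        rcases Nat.eq_zero_or_pos t with rfl | htp
        · simp [hF]
        rw [norm_mul]
        have := Finset.mem_range.1 ht
        exact mul_le_mul_of_nonneg_left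
          ((norm_le_pi_norm _ j).trans (hs _ (by omega))) (abs_nonneg _)
    _ = (∑ t ∈ Finset.range (k + 1), ∑ j, |F t i j|) * M := by rw [Finset.sum_mul]
    _ ≤ α * M := mul_le_mul_of_nonneg_right (sum_range_le_of_l1SystemNorm_le hα h i _) hM

theorem eventually_norm_causalConv_le {α M ε : ℝ} (hα : 0 ≤ α)
    (h : l1SystemNorm F ≤ ENNReal.ofReal α) (hM : 0 ≤ M) (hF : F 0 = 0) (hε : 0 < ε)
    (hs : ∀ᶠ k in atTop, ‖s k‖ ≤ M) : ∀ᶠ k in atTop, ‖causalConv F s k‖ ≤ α * M + ε := by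
  obtain ⟨K, hK⟩ := eventually_atTop.1 hs
  -- The first `K` values of the signal contribute only a vanishing transient; the rest obeys the
  -- bound `M` everywhere.
  have h1 : Tendsto (causalConv F fun j => if j < K then s j else 0) atTop (𝓝 0) :=
    tendsto_causalConv_of_support (fun i j => tendsto_of_l1SystemNorm_le h i j) (K := K)
      fun j hj => if_neg (by omega)
  have h2 := (tendsto_zero_iff_norm_tendsto_zero.1 h1).eventually (eventually_le_nhds hε)
  filter_upwards [h2] with k hk
  have h3 : causalConv F s k = causalConv F (fun j => if j < K then 0 else s j) k +
      causalConv F (fun j => if j < K then s j else 0) k := by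
    rw [← causalConv_add_signal]
    congr 1; funext j; split_ifs <;> simp
  rw [h3]
  refine (norm_add_le _ _).trans (add_le_add ?_ hk)
  refine norm_causalConv_le hα h hM hF fun j _ => ?_
  split_ifs with hj
  · simpa using hM
  · exact hK j (by omega)

end Convolution

/-! ### The controller realization and internal stability. -/

section SystemLevel

variable {n m l : ℕ} {A : Matrix (Fin n) (Fin n) ℝ} {B : Matrix (Fin n) (Fin m) ℝ}
  {C : Matrix (Fin l) (Fin n) ℝ} {Φ : SystemResponse n m l}

theorem SystemResponse.Realizable.xw_one (h : Φ.Realizable A B C) : Φ.xw 1 = 1 := by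
  simpa [h.xw_zero, h.uw_zero] using h.row_w 0

theorem SystemResponse.Realizable.xe_one (h : Φ.Realizable A B C) : Φ.xe 1 = 0 := by
  simpa [h.xe_zero, h.ue_zero] using h.row_e 0

/-- The internal signal of the controller cancels the effect of the input on the model state. -/
theorem SystemResponse.Realizable.internal_state_step (h : Φ.Realizable A B C)
    (β : ℕ → Fin n → ℝ) (y : ℕ → Fin l → ℝ) (k : ℕ) :
    causalConv (fun t => Φ.xw (t + 1)) β (k + 1) + causalConv Φ.xe y (k + 1) =
      β (k + 1) + A.mulVec (causalConv (fun t => Φ.xw (t + 1)) β k + causalConv Φ.xe y k) +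
        B.mulVec (causalConv (fun t => Φ.uw (t + 1)) β k + causalConv Φ.ue y k) := by
  have h1 : (fun t => Φ.xw (t + 1 + 1)) = fun t => A * Φ.xw (t + 1) + B * Φ.uw (t + 1) := by
    funext t
    have := h.row_w (t + 1)
    rw [if_neg (Nat.succ_ne_zero t), sub_sub, sub_eq_zero] at this
    exact this
  have h2 : (fun t => Φ.xe (t + 1)) = fun t => A * Φ.xe t + B * Φ.ue t := by
    funext t
    have := h.row_e t
    rw [sub_sub, sub_eq_zero] at this
    exact this
  rw [causalConv_succ, causalConv_succ, h1, h2, causalConv_add_left, causalConv_add_left]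
  simp only [causalConv_mul_left, zero_add, h.xw_one, h.xe_zero, Matrix.one_mulVec,
    Matrix.zero_mulVec, Matrix.mulVec_add]
  abel

/-- The combination `z Φ_xw β + Φ_xe y` vanishes at all times, so `internal_state_step` leaves `β (k
+ 1) + B u k = 0`. Thus `β` cancels the disturbance that the input represents to the plant. -/
theorem SystemResponse.Realizable.isControlOutput_iff (h : Φ.Realizable A B C)
    {y : ℕ → Fin l → ℝ} {u : ℕ → Fin m → ℝ} :
    Φ.IsControlOutput y u ↔ ∃ β : ℕ → Fin n → ℝ, β 0 = 0 ∧ (∀ k, β (k + 1) = -B.mulVec (u k)) ∧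
      (∀ k, causalConv (fun t => Φ.xw (t + 1)) β k + causalConv Φ.xe y k = 0) ∧
      ∀ k, u k = causalConv (fun t => Φ.uw (t + 1)) β k + causalConv Φ.ue y k := by
  constructor
  · rintro ⟨β, h1, h2⟩
    have h3 : ∀ k, causalConv (fun t => Φ.xw (t + 1)) β k + causalConv Φ.xe y k = 0 :=
      fun k => by rw [← eq_neg_iff_add_eq_zero]; exact h1 k
    refine ⟨β, ?_, fun k => ?_, h3, h2⟩
    · simpa [causalConv_zero, h.xw_one, h.xe_zero] using h3 0
    · have h4 := h.internal_state_step β y k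
      have h5 : u k = causalConv (fun t => Φ.uw (t + 1)) β k + causalConv Φ.ue y k := h2 k
      rw [h3, h3, ← h5, Matrix.mulVec_zero, add_zero] at h4
      exact eq_neg_of_add_eq_zero_left h4.symm
  · rintro ⟨β, -, -, h1, h2⟩
    exact ⟨β, fun k => eq_neg_of_add_eq_zero_left (h1 k), h2⟩

/-- This converse serves to build trajectories: it suffices to generate `β` from past inputs, and
the defining equation of `β` then holds by induction. -/
theorem SystemResponse.Realizable.isControlOutput_of_internal (h : Φ.Realizable A B C)
    {y : ℕ → Fin l → ℝ} {u : ℕ → Fin m → ℝ} {β : ℕ → Fin n → ℝ} (h0 : β 0 = 0)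
    (hβ : ∀ k, β (k + 1) = -B.mulVec (u k))
    (hu : ∀ k, u k = causalConv (fun t => Φ.uw (t + 1)) β k + causalConv Φ.ue y k) :
    Φ.IsControlOutput y u := by
  refine h.isControlOutput_iff.2 ⟨β, h0, hβ, fun k => ?_, hu⟩
  induction k with
  | zero => simp [causalConv_zero, h0, h.xe_zero]
  | succ k ih => rw [h.internal_state_step, ih, ← hu k, hβ k]; simp

/-- Every signal `x` is the response to the disturbances it defines. -/
theorem SystemResponse.Realizable.reproduce (h : Φ.Realizable A B C) (x γ : ℕ → Fin n → ℝ)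
    (h0 : γ 0 = x 0) (hγ : ∀ k, γ (k + 1) = x (k + 1) - A.mulVec (x k)) (k : ℕ) :
    causalConv (fun t => Φ.xw (t + 1)) γ k - causalConv Φ.xe (fun t => C.mulVec (x t)) k = x k := by
  cases k with
  | zero => simp [causalConv_zero, h.xw_one, h.xe_zero, h0]
  | succ k =>
    have h1 : (fun t => Φ.xw (t + 1 + 1)) = fun t => Φ.xw (t + 1) * A + Φ.xe (t + 1) * C := by
      funext t
      have := h.col_x (t + 1)
      rw [if_neg (Nat.succ_ne_zero t), sub_sub, sub_eq_zero] at this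
      exact this
    rw [causalConv_succ']
    simp only [hγ]
    rw [causalConv_sub_signal, ← add_sub_assoc, h0,
      ← causalConv_succ' (fun t => Φ.xw (t + 1)) x, causalConv_succ, h1, causalConv_add_left,
      causalConv_succ, causalConv_mulVec, causalConv_mulVec]
    simp only [zero_add, h.xw_one, h.xe_zero, Matrix.one_mulVec, Matrix.zero_mulVec]
    abel

/-- Internal stability: the response map describes all signals of the loop. -/
theorem SystemResponse.Realizable.state_eq (h : Φ.Realizable A B C) {x γ β : ℕ → Fin n → ℝ}
    {y : ℕ → Fin l → ℝ} (h0 : γ 0 = x 0) (hγ : ∀ k, γ (k + 1) = x (k + 1) - A.mulVec (x k))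
    (hβ : ∀ k, causalConv (fun t => Φ.xw (t + 1)) β k + causalConv Φ.xe y k = 0) (k : ℕ) :
    x k = causalConv (fun t => Φ.xw (t + 1)) (fun t => γ t + β t) k +
      causalConv Φ.xe (fun t => y t - C.mulVec (x t)) k := by
  rw [causalConv_add_signal, causalConv_sub_signal]
  nth_rewrite 1 [← h.reproduce x γ h0 hγ k]
  have := hβ k
  linear_combination (exp := 1) -this

/-- The controller is causal and linear, so over a finite horizon its gain is finite whether or not
it is stable by itself. This controls the internal state created by past measurements. -/
theorem SystemResponse.Realizable.exists_norm_control_le (h : Φ.Realizable A B C) (N : ℕ) :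
    ∃ c, 0 ≤ c ∧ ∀ (y : ℕ → Fin l → ℝ) (u : ℕ → Fin m → ℝ) (δ : ℝ), Φ.IsControlOutput y u →
      (∀ k < N, ‖y k‖ ≤ δ) → ∀ k < N, ‖u k‖ ≤ c * δ := by
  obtain ⟨b, hb, hB⟩ := exists_norm_mulVec_le B
  induction N with
  | zero => exact ⟨0, le_rfl, by simp⟩
  | succ N ih =>
    obtain ⟨c, hc, ih⟩ := ih
    obtain ⟨c₁, hc₁, h₁⟩ := exists_norm_causalConv_le (fun t => Φ.uw (t + 1)) N
    obtain ⟨c₂, hc₂, h₂⟩ := exists_norm_causalConv_le Φ.ue N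
    refine ⟨c + (c₁ * (b * c) + c₂), by positivity, fun y u δ hu hy k hk => ?_⟩
    have hδ : 0 ≤ δ := (norm_nonneg _).trans (hy 0 (Nat.succ_pos N))
    have ih' := ih y u δ hu fun k hk => hy k (by omega)
    rcases (Nat.lt_succ_iff.1 hk).eq_or_lt with rfl | hk
    · obtain ⟨β, hβ0, hβ, -, hu'⟩ := h.isControlOutput_iff.1 hu
      have hβk : ∀ j ≤ k, ‖β j‖ ≤ b * c * δ := by
        intro j hj
        cases j with
        | zero => rw [hβ0, norm_zero]; positivity
        | succ j =>
          rw [hβ, norm_neg, mul_assoc]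
          exact (hB _).trans (mul_le_mul_of_nonneg_left (ih' j (by omega)) hb)
      rw [hu']
      refine (norm_add_le _ _).trans ((add_le_add (h₁ _ _ hβk)
        (h₂ _ δ fun j hj => hy j (by omega))).trans ?_)
      nlinarith [mul_nonneg hc hδ]
    · refine (ih' k hk).trans ?_
      nlinarith [show 0 ≤ (c₁ * (b * c) + c₂) * δ by positivity]

end SystemLevel

/-! ### The small gain theorem. -/

/-- The infimum `L` of the eventual upper bounds, which is the limsup, satisfies `L ≤ ρ * L`, hence
is zero. -/
theorem tendsto_zero_of_contraction {a : ℕ → ℝ} {ρ R : ℝ} (ha : ∀ k, 0 ≤ a k) (hρ : ρ < 1)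
    (hρ0 : 0 ≤ ρ) (hR : ∀ᶠ k in atTop, a k ≤ R)
    (h : ∀ M, 0 ≤ M → (∀ᶠ k in atTop, a k ≤ M) → ∀ ε, 0 < ε → ∀ᶠ k in atTop, a k ≤ ρ * M + ε) :
    Tendsto a atTop (𝓝 0) := by
  set T : Set ℝ := {M | 0 ≤ M ∧ ∀ᶠ k in atTop, a k ≤ M} with hT
  have hne : T.Nonempty := by
    obtain ⟨k, hk⟩ := hR.exists
    exact ⟨R, (ha k).trans hk, hR⟩
  have hbdd : BddBelow T := ⟨0, fun M hM => hM.1⟩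
  have hL0 : 0 ≤ sInf T := le_csInf hne fun M hM => hM.1
  have hL : sInf T = 0 := by
    by_contra hne0
    have hpos : 0 < sInf T := lt_of_le_of_ne hL0 (Ne.symm hne0)
    set ε := (1 - ρ) * sInf T / 3 with hε
    have hεp : 0 < ε := div_pos (mul_pos (by linarith) hpos) (by norm_num)
    obtain ⟨M, hM, hMlt⟩ := exists_lt_of_csInf_lt hne (show sInf T < sInf T + ε by linarith)
    have h1 : ρ * M + ε ∈ T := ⟨by have := hM.1; positivity, h M hM.1 hM.2 ε hεp⟩
    have h2 := csInf_le hbdd h1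
    have h3 : ρ * M ≤ ρ * (sInf T + ε) := mul_le_mul_of_nonneg_left hMlt.le hρ0
    have h4 : ρ * ε ≤ ε := by nlinarith
    have h5 : (1 - ρ) * sInf T = 3 * ε := by rw [hε]; ring
    nlinarith
  rw [Metric.tendsto_nhds]
  intro ε hε
  obtain ⟨M, hM, hMlt⟩ := exists_lt_of_csInf_lt hne (show sInf T < ε by rw [hL]; exact hε)
  filter_upwards [hM.2] with k hk
  rw [Real.dist_eq, sub_zero, abs_of_nonneg (ha k)]
  linarith

namespace SystemResponse

variable {n m l : ℕ} {A : Matrix (Fin n) (Fin n) ℝ} {B : Matrix (Fin n) (Fin m) ℝ}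
  {C : Matrix (Fin l) (Fin n) ℝ} {Φ : SystemResponse n m l}

theorem exists_abs_coeff_le (h : Φ.h2NormSq < ⊤) : ∃ c, 0 ≤ c ∧ ∀ i, |Φ.coeff i| ≤ c := by
  have hs := summable_of_h2NormSq_lt_top h
  refine ⟨√(∑' i, Φ.coeff i ^ 2), Real.sqrt_nonneg _, fun i => Real.abs_le_sqrt ?_⟩
  exact hs.le_tsum i fun _ _ => sq_nonneg _

theorem tendsto_coeff (h : Φ.h2NormSq < ⊤)
    (p : ((Fin n × Fin n) ⊕ (Fin n × Fin l)) ⊕ ((Fin m × Fin n) ⊕ (Fin m × Fin l))) :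
    Tendsto (fun t => Φ.coeff (t, p)) atTop (𝓝 0) := by
  have hs := (summable_of_h2NormSq_lt_top h).comp_injective
    (i := fun t : ℕ => (t, p)) (fun a b hab => (Prod.mk.inj hab).1)
  have h1 := (hs.tendsto_atTop_zero).sqrt
  simp only [Function.comp_def, Real.sqrt_sq_eq_abs, Real.sqrt_zero] at h1
  exact (tendsto_zero_iff_abs_tendsto_zero _).2 h1

/-- Small gain bound for the closed loop with a slope bounded measurement error. -/
theorem Realizable.closedLoop_bound (h : Φ.Realizable A B C) (hfin : Φ.h2NormSq < ⊤)
    {α S : ℝ} (hα : 0 ≤ α) (hl1 : l1SystemNorm Φ.xe ≤ ENNReal.ofReal α) (hS : 0 ≤ S)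
    (hαS : α * S < 1) {e : (Fin n → ℝ) → Fin l → ℝ} (he : ∀ x, ‖e x‖ ≤ S * ‖x‖) (N : ℕ) :
    ∃ c, 0 ≤ c ∧ ∀ δ η ξ x y u, IsClosedLoopTrajectory A B C Φ e N η ξ x y u →
      (∀ k, k < N → ‖η k‖ ≤ δ) → ‖ξ‖ ≤ δ →
        (∀ k, N ≤ k → ‖x k‖ ≤ c * δ) ∧ Tendsto x atTop (𝓝 0) := by
  obtain ⟨b, hb, hB⟩ := exists_norm_mulVec_le B
  obtain ⟨c₁, hc₁, hu⟩ := h.exists_norm_control_le N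
  obtain ⟨f, hf, hfb⟩ := exists_abs_coeff_le hfin
  have hpos : 0 < 1 - α * S := by linarith
  -- `R` solves `R = transient + α * (1 + S * R)`: errors are at most `δ` before time `N` and at
  -- most `S * R * δ` after it. This makes the bound reproduce itself.
  set R := ((N + 1 : ℕ) * (n * f * (1 + b * c₁)) + α) / (1 - α * S) with hR
  refine ⟨R, by positivity, fun δ η ξ x y u ht hη hξ => ?_⟩
  have hδ : 0 ≤ δ := (norm_nonneg _).trans hξ
  obtain ⟨β, hβ0, hβ, hβ0', -⟩ := h.isControlOutput_iff.1 ht.control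
  have hub := hu y u δ ht.control fun k hk => by rw [ht.past k hk]; exact hη k hk
  -- Setting the state to zero before `N` turns the past measurements into measurement errors, so
  -- that one response formula covers all times.
  set x' : ℕ → Fin n → ℝ := fun k => if k < N then 0 else x k with hx'
  set γ : ℕ → Fin n → ℝ := fun k => k.rec (x' 0) fun j _ => x' (j + 1) - A.mulVec (x' j) with hγ
  have hx := h.state_eq (x := x') (γ := γ) (β := β) (y := y) rfl (fun _ => rfl) hβ0'
  have hβb : ∀ j ≤ N, ‖β j‖ ≤ b * c₁ * δ := by
    intro j hj
    cases j with
    | zero => rw [hβ0, norm_zero]; positivity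
    | succ j =>
      rw [hβ, norm_neg, mul_assoc]
      exact (hB _).trans (mul_le_mul_of_nonneg_left (hub j (by omega)) hb)
  have hγb : ∀ j ≤ N, ‖γ j‖ ≤ δ := by
    intro j hj
    cases j with
    | zero =>
      change ‖x' 0‖ ≤ δ
      rcases Nat.eq_zero_or_pos N with rfl | hN
      · simpa [hx', ht.init] using hξ
      · simpa [hx', hN] using hδ
    | succ j =>
      change ‖x' (j + 1) - A.mulVec (x' j)‖ ≤ δ
      have : x' j = 0 := if_pos (by omega)
      rw [this, Matrix.mulVec_zero, sub_zero]
      rcases hj.eq_or_lt with rfl | hj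
      · simpa [hx', ht.init] using hξ
      · simpa [hx', hj] using hδ
  -- Once the loop is closed, the plant equation makes `γ` equal to `B u`, which `β` cancels. Only
  -- finitely many disturbances remain.
  have hsupp : ∀ j, N + 1 ≤ j → γ j + β j = 0 := by
    intro j hj
    obtain ⟨i, rfl⟩ : ∃ i, j = i + 1 := ⟨j - 1, by omega⟩
    have h1 : x' (i + 1) = x (i + 1) := if_neg (by omega)
    have h2 : x' i = x i := if_neg (by omega)
    change x' (i + 1) - A.mulVec (x' i) + β (i + 1) = 0
    rw [h1, h2, hβ, ht.dynamics i (by omega)]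
    abel
  have hω : ∀ j, ‖γ j + β j‖ ≤ (1 + b * c₁) * δ := by
    intro j
    rcases le_or_gt j N with hj | hj
    · refine (norm_add_le _ _).trans ((add_le_add (hγb j hj) (hβb j hj)).trans (le_of_eq ?_))
      ring
    · rw [hsupp j hj, norm_zero]; positivity
  have hT : ∀ k, ‖causalConv (fun t => Φ.xw (t + 1)) (fun t => γ t + β t) k‖ ≤
      (N + 1 : ℕ) * (n * f * ((1 + b * c₁) * δ)) :=
    norm_causalConv_le_of_support hf (fun t i j => hfb (t + 1, .inl (.inl (i, j)))) hsupp hω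
  have hT0 : Tendsto (causalConv (fun t => Φ.xw (t + 1)) (fun t => γ t + β t)) atTop (𝓝 0) :=
    tendsto_causalConv_of_support (fun i j =>
      (tendsto_coeff hfin (.inl (.inl (i, j)))).comp (tendsto_add_atTop_nat 1)) hsupp
  have hpast : ∀ j < N, ‖y j - C.mulVec (x' j)‖ ≤ δ := by
    intro j hj
    have : x' j = 0 := if_pos hj
    rw [this, Matrix.mulVec_zero, sub_zero, ht.past j hj]
    exact hη j hj
  have herr : ∀ j, N ≤ j → ‖y j - C.mulVec (x' j)‖ ≤ S * ‖x' j‖ := by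
    intro j hj
    have : x' j = x j := if_neg (by omega)
    rw [this, ht.measurement j hj, add_sub_cancel_left]
    exact he _
  have hRR : R * δ * (1 - α * S) =
      (N + 1 : ℕ) * (n * f * ((1 + b * c₁) * δ)) + α * δ := by
    rw [hR]; field_simp
  have hR0 : 0 ≤ R * δ := mul_nonneg (by positivity) hδ
  have hbound : ∀ k, ‖x' k‖ ≤ R * δ := by
    intro k
    induction k using Nat.strong_induction_on with
    -- The induction is not circular because `Φ.xe 0 = 0`: the state at `k` depends only on errors
    -- before `k`.
    | _ k ih =>
      rw [hx k]
      refine (norm_add_le _ _).trans ((add_le_add (hT k) (norm_causalConv_le hα hl1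
        (M := δ + S * (R * δ)) (by positivity) h.xe_zero fun j hj => ?_)).trans (by linarith))
      rcases lt_or_ge j N with hjN | hjN
      · exact (hpast j hjN).trans (le_add_of_nonneg_right (by positivity))
      · exact (herr j hjN).trans ((mul_le_mul_of_nonneg_left (ih j hj) hS).trans
          (le_add_of_nonneg_left hδ))
  have hxx : ∀ k, N ≤ k → x' k = x k := fun k hk => if_neg (by omega)
  refine ⟨fun k hk => by rw [← hxx k hk]; exact hbound k, ?_⟩
  have hconv : Tendsto x' atTop (𝓝 0) := by
    rw [tendsto_zero_iff_norm_tendsto_zero]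
    refine tendsto_zero_of_contraction (fun k => norm_nonneg _) hαS (by positivity)
      (Eventually.of_forall hbound) fun M hM hev ε hε => ?_
    have h1 : ∀ᶠ k in atTop, ‖y k - C.mulVec (x' k)‖ ≤ S * M := by
      filter_upwards [hev, eventually_ge_atTop N] with k hk hkN
      exact (herr k hkN).trans (mul_le_mul_of_nonneg_left hk hS)
    have h2 := eventually_norm_causalConv_le hα hl1 (by positivity) h.xe_zero (half_pos hε) h1
    have h3 := (tendsto_zero_iff_norm_tendsto_zero.1 hT0).eventually
      (eventually_le_nhds (half_pos hε))
    filter_upwards [h2, h3] with k hk2 hk3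
    rw [hx k]
    refine (norm_add_le _ _).trans ((add_le_add hk3 hk2).trans (le_of_eq ?_))
    ring
  refine hconv.congr' ?_
  filter_upwards [eventually_ge_atTop N] with k hk using hxx k hk

/-- Small gain theorem for system responses. -/
theorem Realizable.closedLoop_asymptoticallyStable (h : Φ.Realizable A B C)
    (hfin : Φ.h2NormSq < ⊤) {α S : ℝ} (hα : 0 ≤ α)
    (hl1 : l1SystemNorm Φ.xe ≤ ENNReal.ofReal α) (hS : 0 ≤ S) (hαS : α * S < 1)
    {e : (Fin n → ℝ) → Fin l → ℝ} (he : ∀ x, ‖e x‖ ≤ S * ‖x‖)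
    {D : Matrix (Fin m) (Fin n) ℝ} (hD : D * B = 1) :
    ClosedLoopAsymptoticallyStable A B C Φ e := by
  obtain ⟨d, hd, hDb⟩ := exists_norm_mulVec_le D
  obtain ⟨a, ha, hA⟩ := exists_norm_mulVec_le A
  have hu : ∀ {N η ξ x y u}, IsClosedLoopTrajectory A B C Φ e N η ξ x y u → ∀ k, N ≤ k →
      u k = D.mulVec (x (k + 1) - A.mulVec (x k)) := by
    intro N η ξ x y u ht k hk
    rw [ht.dynamics k hk, add_sub_cancel_left, Matrix.mulVec_mulVec, hD, Matrix.one_mulVec]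
  refine ⟨fun N ε hε => ?_, fun N => ?_⟩
  · obtain ⟨c, hc, hb⟩ := h.closedLoop_bound hfin hα hl1 hS hαS he N
    set κ := c + d * (c + a * c) + 1 with hκ
    have hκp : 0 < κ := by positivity
    refine ⟨ε / κ, by positivity, fun η ξ x y u ht hη hξ k hk => ?_⟩
    set δ := ε / κ with hδ
    have hδp : 0 < δ := by positivity
    obtain ⟨hx, -⟩ := hb δ η ξ x y u ht (fun k hk => (hη k hk).le) hξ.le
    have hεκ : ε = κ * δ := by rw [hδ]; field_simp
    have h1 : 0 ≤ d * (c + a * c) * δ := by positivity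
    have h2 : 0 ≤ c * δ := by positivity
    constructor
    · refine (hx k hk).trans_lt ?_
      rw [hεκ, hκ]; linarith
    · rw [hu ht k hk]
      have h3 : ‖x (k + 1) - A.mulVec (x k)‖ ≤ (c + a * c) * δ := by
        refine (norm_sub_le _ _).trans ((add_le_add (hx _ (by omega))
          ((hA _).trans (mul_le_mul_of_nonneg_left (hx k hk) ha))).trans (le_of_eq ?_))
        ring
      refine ((hDb _).trans (mul_le_mul_of_nonneg_left h3 hd)).trans_lt ?_
      rw [hεκ, hκ]; linarith
  · obtain ⟨c, hc, hb⟩ := h.closedLoop_bound hfin hα hl1 hS hαS he N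
    refine ⟨1, one_pos, fun η ξ x y u ht hη hξ => ?_⟩
    obtain ⟨-, hx⟩ := hb 1 η ξ x y u ht (fun k hk => (hη k hk).le) hξ.le
    refine ⟨hx, ?_⟩
    have hcA : Continuous fun v : Fin n → ℝ => A.mulVec v := continuous_const.matrix_mulVec continuous_id
    have hcD : Continuous fun v : Fin n → ℝ => D.mulVec v := continuous_const.matrix_mulVec continuous_id
    have h1 : Tendsto (fun k => D.mulVec (x (k + 1) - A.mulVec (x k))) atTop (𝓝 0) := by
      have h2 := (hx.comp (tendsto_add_atTop_nat 1)).sub ((hcA.tendsto 0).comp hx)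
      have h3 := (hcD.tendsto _).comp h2
      simpa [Function.comp_def] using h3
    refine h1.congr' ?_
    filter_upwards [eventually_ge_atTop N] with k hk using (hu ht k hk).symm

end SystemResponse

/-! ### Existence and form of closed-loop trajectories. -/

theorem exists_strong_recursion {Z : Type*} (G : (k : ℕ) → ((j : ℕ) → j < k → Z) → Z) :
    ∃ z : ℕ → Z, ∀ k, z k = G k fun j _ => z j :=
  ⟨fun k => Nat.lt_wfRel.wf.fix G k, fun k => Nat.lt_wfRel.wf.fix_eq G k⟩

theorem causalConv_congr {a b : ℕ} {F : ℕ → Matrix (Fin a) (Fin b) ℝ} {s r : ℕ → Fin b → ℝ}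
    {k : ℕ} (h : ∀ j ≤ k, s j = r j) : causalConv F s k = causalConv F r k :=
  Finset.sum_congr rfl fun t _ => by rw [h _ (Nat.sub_le _ _)]

theorem causalConv_congr_of_lt {a b : ℕ} {F : ℕ → Matrix (Fin a) (Fin b) ℝ}
    {s r : ℕ → Fin b → ℝ} (hF : F 0 = 0) {k : ℕ} (h : ∀ j < k, s j = r j) :
    causalConv F s k = causalConv F r k := by
  refine Finset.sum_congr rfl fun t ht => ?_
  have := Finset.mem_range.1 ht
  rcases Nat.eq_zero_or_pos t with rfl | htp
  · simp [hF]
  · rw [h _ (by omega)]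

section Trajectories

variable {n m l : ℕ} {A : Matrix (Fin n) (Fin n) ℝ} {B : Matrix (Fin n) (Fin m) ℝ}
  {C : Matrix (Fin l) (Fin n) ℝ} {Φ : SystemResponse n m l}

theorem SystemResponse.Realizable.exists_trajectory (h : Φ.Realizable A B C)
    (e : (Fin n → ℝ) → Fin l → ℝ) (η : ℕ → Fin l → ℝ) (ξ : Fin n → ℝ) :
    ∃ x y u, IsClosedLoopTrajectory A B C Φ e 0 η ξ x y u := by
  let ext : (k : ℕ) → ((j : ℕ) → j < k → (Fin n → ℝ) × (Fin m → ℝ)) →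
      ℕ → (Fin n → ℝ) × (Fin m → ℝ) := fun k r j => if hj : j < k then r j hj else 0
  let inner : (ℕ → (Fin n → ℝ) × (Fin m → ℝ)) → ℕ → Fin n → ℝ := fun z j =>
    j.rec 0 fun i _ => -B.mulVec (z i).2
  let meas : (ℕ → (Fin n → ℝ) × (Fin m → ℝ)) → ℕ → Fin l → ℝ := fun z j =>
    C.mulVec (z j).1 + e (z j).1
  let state : (ℕ → (Fin n → ℝ) × (Fin m → ℝ)) → ℕ → Fin n → ℝ := fun z k =>
    k.rec ξ fun i _ => A.mulVec (z i).1 + B.mulVec (z i).2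
  obtain ⟨z, hz⟩ := exists_strong_recursion fun k r =>
    (state (ext k r) k, causalConv (fun t => Φ.uw (t + 1)) (inner (ext k r)) k +
      causalConv Φ.ue (meas (ext k r)) k)
  have hext : ∀ k j, j < k → ext k (fun j _ => z j) j = z j := fun k j hj => dif_pos hj
  have hx : ∀ k, (z k).1 = state z k := by
    intro k
    rw [hz k]
    cases k with
    | zero => rfl
    | succ k =>
      change A.mulVec (ext (k + 1) (fun j _ => z j) k).1 +
        B.mulVec (ext (k + 1) (fun j _ => z j) k).2 = A.mulVec (z k).1 + B.mulVec (z k).2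
      rw [hext _ _ (Nat.lt_succ_self k)]
  have hu : ∀ k, (z k).2 = causalConv (fun t => Φ.uw (t + 1)) (inner z) k +
      causalConv Φ.ue (meas z) k := by
    intro k
    rw [hz k]
    change causalConv _ (inner (ext k fun j _ => z j)) k +
      causalConv _ (meas (ext k fun j _ => z j)) k = _
    congr 1
    · refine causalConv_congr fun j hj => ?_
      cases j with
      | zero => rfl
      | succ j =>
        change -B.mulVec (ext k (fun j _ => z j) j).2 = -B.mulVec (z j).2
        rw [hext _ _ hj]
    -- Since `Φ.ue 0 = 0`, the input does not depend on the current measurement, so there is no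
    -- algebraic loop.
    · refine causalConv_congr_of_lt h.ue_zero fun j hj => ?_
      change C.mulVec (ext k (fun j _ => z j) j).1 + e (ext k (fun j _ => z j) j).1 =
        C.mulVec (z j).1 + e (z j).1
      rw [hext _ _ hj]
  refine ⟨fun k => (z k).1, meas z, fun k => (z k).2, ?_, hx 0, fun k _ => hx (k + 1),
    fun k _ => rfl, h.isControlOutput_of_internal (β := inner z) rfl (fun _ => rfl) hu⟩
  exact fun k hk => absurd hk (Nat.not_lt_zero k)

/-- Trajectories without past measurements are responses to the initial state and the errors. -/
theorem SystemResponse.Realizable.trajectory_eq (h : Φ.Realizable A B C)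
    {e : (Fin n → ℝ) → Fin l → ℝ} {η : ℕ → Fin l → ℝ} {ξ : Fin n → ℝ} {x : ℕ → Fin n → ℝ}
    {y : ℕ → Fin l → ℝ} {u : ℕ → Fin m → ℝ}
    (ht : IsClosedLoopTrajectory A B C Φ e 0 η ξ x y u) (k : ℕ) :
    x k = (Φ.xw (k + 1)).mulVec ξ + causalConv Φ.xe (fun t => e (x t)) k := by
  obtain ⟨β, hβ0, hβ, hβ0', -⟩ := h.isControlOutput_iff.1 ht.control
  set γ : ℕ → Fin n → ℝ := fun k => k.rec (x 0) fun j _ => x (j + 1) - A.mulVec (x j) with hγ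
  have hx := h.state_eq (x := x) (γ := γ) (β := β) (y := y) rfl (fun _ => rfl) hβ0' k
  have h1 : ∀ j, 1 ≤ j → γ j + β j = 0 := by
    intro j hj
    obtain ⟨i, rfl⟩ : ∃ i, j = i + 1 := ⟨j - 1, by omega⟩
    change x (i + 1) - A.mulVec (x i) + β (i + 1) = 0
    rw [hβ, ht.dynamics i (Nat.zero_le i)]
    abel
  have h2 : γ 0 + β 0 = ξ := by
    change x 0 + β 0 = ξ
    rw [hβ0, ht.init, add_zero]
  rcases Nat.eq_zero_or_pos k with rfl | hk
  · rw [hx, causalConv_zero, causalConv_zero, causalConv_zero, h2, h.xe_zero]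
    simp
  · rw [hx, causalConv_of_support _ _ h1 hk, Finset.sum_range_one, h2, Nat.sub_zero]
    congr 1
    refine causalConv_congr fun j _ => ?_
    rw [ht.measurement j (Nat.zero_le j), add_sub_cancel_left]

end Trajectories

/-! ### A renewal equation with kernel of mass one. -/

section Renewal

theorem tendsto_sum_range_conv_zero {τ a : ℕ → ℝ} (hτ : Summable fun t => |τ t|)
    (ha : Tendsto a atTop (𝓝 0)) :
    Tendsto (fun k => ∑ t ∈ Finset.range (k + 1), τ t * a (k - t)) atTop (𝓝 0) := by
  obtain ⟨M, hM⟩ := ha.abs.bddAbove_range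
  have hM' : ∀ k, |a k| ≤ M := fun k => hM ⟨k, rfl⟩
  have h := tendsto_tsum_of_dominated_convergence (𝓕 := atTop)
    (f := fun k t => if t ∈ Finset.range (k + 1) then τ t * a (k - t) else 0)
    (g := fun _ => (0 : ℝ)) (bound := fun t => |τ t| * M) (hτ.mul_right M) ?_ ?_
  · rw [tsum_zero] at h
    refine h.congr fun k => ?_
    rw [tsum_eq_sum (s := Finset.range (k + 1)) fun t ht => if_neg ht]
    exact Finset.sum_congr rfl fun t ht => if_pos ht
  · intro t
    have h1 : Tendsto (fun k => τ t * a (k - t)) atTop (𝓝 (τ t * 0)) :=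
      (ha.comp (tendsto_sub_atTop_nat t)).const_mul _
    rw [mul_zero] at h1
    refine h1.congr' ?_
    filter_upwards [eventually_ge_atTop t] with k hk
    rw [if_pos (Finset.mem_range.2 (by omega))]
  · refine Eventually.of_forall fun k t => ?_
    split_ifs
    · rw [Real.norm_eq_abs, abs_mul]
      exact mul_le_mul_of_nonneg_left (hM' _) (abs_nonneg _)
    · rw [norm_zero]
      exact mul_nonneg (abs_nonneg _) ((abs_nonneg _).trans (hM' 0))

/-- A renewal equation whose kernel has total mass one and summable tails `τ` has no solution that
tends to zero, unless the forcing term has zero sum. -/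
theorem renewal_sum_eq_zero {a g p τ : ℕ → ℝ} {G : ℝ} (hp : p 0 = 0) (hτ0 : τ 0 = 1)
    (hτp : ∀ t, τ (t + 1) = τ t - p (t + 1)) (hτ : Summable fun t => |τ t|) (hg : HasSum g G)
    (h : ∀ k, a k = g k + ∑ t ∈ Finset.range (k + 1), p t * a (k - t))
    (ha : Tendsto a atTop (𝓝 0)) : G = 0 := by
  -- This is the renewal equation `(1 - p) * a = g` divided by `1 - z⁻¹`: the quotient of `1 - p` is
  -- the tail sequence `τ`, that of `g` its partial sums.
  have h1 : ∀ k, ∑ t ∈ Finset.range (k + 1), τ t * a (k - t) =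
      ∑ j ∈ Finset.range (k + 1), g j := by
    intro k
    induction k with
    | zero =>
      have := h 0
      simp [hp] at this
      simp [hτ0, this]
    | succ k ih =>
      rw [Finset.sum_range_succ (fun j => g j), ← ih, Finset.sum_range_succ']
      have h2 := h (k + 1)
      rw [Finset.sum_range_succ'] at h2
      simp only [hp, zero_mul, add_zero, Nat.add_sub_add_right] at h2
      simp only [hτp, sub_mul, Finset.sum_sub_distrib, hτ0, Nat.sub_zero, one_mul,
        Nat.add_sub_add_right]
      linarith
  have h2 := tendsto_sum_range_conv_zero hτ ha
  simp only [h1] at h2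
  exact tendsto_nhds_unique ((hg.tendsto_sum_nat).comp (tendsto_add_atTop_nat 1)) h2

end Renewal

/-! ### The filter Riccati equation. -/

/-- The root is the determinant of the observer matrix `H`. The quartic is palindromic because the
eigenvalues of the Riccati pencil come in reciprocal pairs. -/
theorem exists_quartic_root : ∃ d : ℝ, d ^ 4 - 37 / 4 * d ^ 3 + 31 / 2 * d ^ 2 - 37 / 4 * d + 1 = 0 ∧
    0.1370429453 ≤ d ∧ d ≤ 0.1370429456 := by
  have hc : ContinuousOn (fun d : ℝ => d ^ 4 - 37 / 4 * d ^ 3 + 31 / 2 * d ^ 2 - 37 / 4 * d + 1)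
      (Set.Icc 0.1370429453 0.1370429456) := by fun_prop
  obtain ⟨d, hd, h⟩ := intermediate_value_Icc' (by norm_num) hc
    (show (0 : ℝ) ∈ Set.Icc _ _ by constructor <;> norm_num)
  exact ⟨d, h, hd.1, hd.2⟩

/-- The stabilizing solution of the filter Riccati equation of the double integrator, in terms of
the state matrix `H` of the estimation error and the error covariance `Y`. -/
theorem exists_filter_riccati : ∃ H Y : Matrix (Fin 2) (Fin 2) ℝ,
    Y = 1 + H * Y * (doubleIntegratorA 0.5).transpose ∧ H * Y = doubleIntegratorA 0.5 - H ∧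
    |H 0 0 - 0.333497535| ≤ 1 / 10 ^ 7 ∧ |H 0 1 - 0.146365323| ≤ 1 / 10 ^ 7 ∧
    |H 1 0 + 0.048463138| ≤ 1 / 10 ^ 7 ∧ |H 1 1 - 0.389656921| ≤ 1 / 10 ^ 7 := by
  obtain ⟨d, hd, hl, hu⟩ := exists_quartic_root
  have h2l : 0.0187807688 ≤ d ^ 2 := by nlinarith
  have h2u : d ^ 2 ≤ 0.0187807690 := by nlinarith
  have h3l : 0.0025737718 ≤ d ^ 3 := by nlinarith
  have h3u : d ^ 3 ≤ 0.0025737720 := by nlinarith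
  -- The entries of `H` lie in `ℚ(d)`, hence are cubic polynomials in `d`.
  set a := -2 / 9 + 293 / 72 * d - 7 / 72 * d ^ 2 - 1 / 18 * d ^ 3 with ha
  set b := -25 / 36 + 257 / 36 * d - 67 / 9 * d ^ 2 + 8 / 9 * d ^ 3 with hb
  set c := -8 / 9 + 253 / 36 * d - 239 / 36 * d ^ 2 + 7 / 9 * d ^ 3 with hc
  set e := 7 / 18 + 2 / 9 * d - 29 / 18 * d ^ 2 + 2 / 9 * d ^ 3 with he
  -- Substituting `H * Y = A - H` into the first equation gives `Y = 1 + (A - H) * Aᵀ`; only this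
  -- one equation for `H` remains.
  have key : !![a, b; c, e] * (1 + (doubleIntegratorA 0.5 - !![a, b; c, e]) *
      (doubleIntegratorA 0.5).transpose) = doubleIntegratorA 0.5 - !![a, b; c, e] := by
    have hT : (doubleIntegratorA 0.5).transpose = !![1, 0; 0.5, 1] := by
      ext i j; fin_cases i <;> fin_cases j <;> rfl
    rw [hT, doubleIntegratorA, Matrix.one_fin_two]
    ext i j
    fin_cases i <;> fin_cases j <;> simp [Matrix.mul_apply, Fin.sum_univ_two]
    · simp only [ha, hb, hc, he]; linear_combination (-1157/432 + 857/144*d - 83/108*d^2) * hd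
    · simp only [ha, hb, he]; linear_combination (-557/216 + 25/18*d - 4/27*d^2) * hd
    · simp only [ha, hb, hc, he]; linear_combination (-211/72 + 289/72*d - 1/2*d^2) * hd
    · simp only [hb, hc, he]; linear_combination (-113/108 + 50/9*d - 20/27*d^2) * hd
  refine ⟨!![a, b; c, e], 1 + (doubleIntegratorA 0.5 - !![a, b; c, e]) *
    (doubleIntegratorA 0.5).transpose, by rw [key], key, ?_, ?_, ?_, ?_⟩
  all_goals
    simp only [Matrix.of_apply, Matrix.cons_val_zero, Matrix.cons_val_one, Matrix.cons_val', Matrix.cons_val_fin_one]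
    rw [abs_le]
    constructor <;> linarith

/-! ### Optimality of observer-based feedback. -/

section Lqg

variable {n m : ℕ}

/-- Response from `w` to the state estimate of the observer with error state matrix `H` and
feedback gain `K`, delayed by one step. -/
def estimateResponse (A : Matrix (Fin n) (Fin n) ℝ) (B : Matrix (Fin n) (Fin m) ℝ)
    (K : Matrix (Fin m) (Fin n) ℝ) (H : Matrix (Fin n) (Fin n) ℝ) : ℕ → Matrix (Fin n) (Fin n) ℝ
  | 0 => 0
  | k + 1 => (A + B * K) * estimateResponse A B K H k + (A - H) * H ^ k

/-- Response from `e` to the state estimate, delayed by one step. -/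
def estimateErrorResponse (A : Matrix (Fin n) (Fin n) ℝ) (B : Matrix (Fin n) (Fin m) ℝ)
    (K : Matrix (Fin m) (Fin n) ℝ) (H : Matrix (Fin n) (Fin n) ℝ) (k : ℕ) :
    Matrix (Fin n) (Fin n) ℝ :=
  estimateResponse A B K H (k + 1) - estimateResponse A B K H k * A

/-- System response of observer based feedback with full state measurement. -/
def observerResponse (A : Matrix (Fin n) (Fin n) ℝ) (B : Matrix (Fin n) (Fin m) ℝ)
    (K : Matrix (Fin m) (Fin n) ℝ) (H : Matrix (Fin n) (Fin n) ℝ) : SystemResponse n m n where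
  xw t := t.casesOn 0 fun k => H ^ k + estimateResponse A B K H k
  xe t := t.casesOn 0 fun k => estimateErrorResponse A B K H k - H ^ k * (A - H)
  uw t := t.casesOn 0 fun k => K * estimateResponse A B K H k
  ue t := t.casesOn 0 fun k => K * estimateErrorResponse A B K H k

variable {A : Matrix (Fin n) (Fin n) ℝ} {B : Matrix (Fin n) (Fin m) ℝ}
  {K : Matrix (Fin m) (Fin n) ℝ} {H : Matrix (Fin n) (Fin n) ℝ}

theorem estimateErrorResponse_succ (k : ℕ) : estimateErrorResponse A B K H (k + 1) =
    (A + B * K) * estimateErrorResponse A B K H k - (A - H) * H ^ k * (A - H) := by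
  simp only [estimateErrorResponse, estimateResponse]
  rw [pow_succ]
  noncomm_ring

theorem observerResponse_realizable : (observerResponse A B K H).Realizable A B 1 := by
  constructor
  · rfl
  · rfl
  · rfl
  · rfl
  · rintro (_ | k)
    · simp [observerResponse, estimateResponse]
    · simp only [observerResponse, estimateResponse, Nat.succ_ne_zero, if_false]
      rw [pow_succ', ← Matrix.mul_assoc B K]
      noncomm_ring
  · rintro (_ | k)
    · simp [observerResponse, estimateResponse, estimateErrorResponse]
    · simp only [observerResponse, estimateErrorResponse_succ]
      rw [pow_succ', ← Matrix.mul_assoc B K]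
      noncomm_ring
  · rintro (_ | k)
    · simp [observerResponse, estimateResponse]
    · simp only [observerResponse, estimateErrorResponse, Nat.succ_ne_zero, if_false]
      rw [pow_succ]
      noncomm_ring
  · rintro (_ | k)
    · simp [observerResponse, estimateResponse]
    · simp only [observerResponse, estimateErrorResponse]
      rw [Matrix.mul_one, Matrix.mul_assoc K, Matrix.mul_sub K]
      noncomm_ring

/-- Frobenius inner product. -/
def frobInner {a b : ℕ} (M N : Matrix (Fin a) (Fin b) ℝ) : ℝ := ∑ i, ∑ j, M i j * N i j

theorem frobInner_eq_trace {a b : ℕ} (M N : Matrix (Fin a) (Fin b) ℝ) :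
    frobInner M N = (M.transpose * N).trace := by
  simp only [frobInner, Matrix.trace, Matrix.diag, Matrix.mul_apply, Matrix.transpose_apply]
  exact Finset.sum_comm

theorem frobInner_add_left {a b : ℕ} (M M' N : Matrix (Fin a) (Fin b) ℝ) :
    frobInner (M + M') N = frobInner M N + frobInner M' N := by
  simp [frobInner_eq_trace, Matrix.add_mul]

theorem frobInner_sub_left {a b : ℕ} (M M' N : Matrix (Fin a) (Fin b) ℝ) :
    frobInner (M - M') N = frobInner M N - frobInner M' N := by
  simp [frobInner_eq_trace, Matrix.sub_mul]

theorem frobInner_neg_left {a b : ℕ} (M N : Matrix (Fin a) (Fin b) ℝ) :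
    frobInner (-M) N = -frobInner M N := by
  simp [frobInner_eq_trace]

theorem frobInner_add_right {a b : ℕ} (M N N' : Matrix (Fin a) (Fin b) ℝ) :
    frobInner M (N + N') = frobInner M N + frobInner M N' := by
  simp [frobInner_eq_trace, Matrix.mul_add]

theorem frobInner_mul_left {a b c : ℕ} (X : Matrix (Fin c) (Fin a) ℝ)
    (M : Matrix (Fin a) (Fin b) ℝ) (N : Matrix (Fin c) (Fin b) ℝ) :
    frobInner (X * M) N = frobInner M (X.transpose * N) := by
  simp [frobInner_eq_trace, Matrix.transpose_mul, Matrix.mul_assoc]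

theorem frobInner_mul_right {a b c : ℕ} (M : Matrix (Fin a) (Fin b) ℝ)
    (X : Matrix (Fin b) (Fin c) ℝ) (N : Matrix (Fin a) (Fin c) ℝ) :
    frobInner (M * X) N = frobInner M (N * X.transpose) := by
  rw [frobInner_eq_trace, frobInner_eq_trace, Matrix.transpose_mul, Matrix.mul_assoc,
    Matrix.trace_mul_comm, Matrix.mul_assoc]

theorem tendsto_frobInner {a b : ℕ} {M N : ℕ → Matrix (Fin a) (Fin b) ℝ}
    (hM : Tendsto M atTop (𝓝 0)) (hN : Tendsto N atTop (𝓝 0)) :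
    Tendsto (fun k => frobInner (M k) (N k)) atTop (𝓝 0) := by
  have h : Tendsto (fun k => frobInner (M k) (N k)) atTop
      (𝓝 (∑ i : Fin a, ∑ j : Fin b, (0 : ℝ) * 0)) := by
    refine tendsto_finsetSum _ fun i _ => tendsto_finsetSum _ fun j _ => ?_
    exact (tendsto_pi_nhds.1 (tendsto_pi_nhds.1 hM i) j).mul
      (tendsto_pi_nhds.1 (tendsto_pi_nhds.1 hN i) j)
  simpa using h

/-- Telescoping form of the filter Riccati equation. -/
theorem frobInner_filter_telescope {Y : Matrix (Fin n) (Fin n) ℝ}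
    (hY : Y = 1 + H * Y * A.transpose) (hHY : H * Y = A - H)
    (M : Matrix (Fin n) (Fin n) ℝ) {δ δ' η : Matrix (Fin n) (Fin n) ℝ} (h : δ' = δ * A + η) :
    frobInner M δ - frobInner (M * (A - H)) η =
      frobInner (M * Y) δ - frobInner (M * H * Y) δ' := by
  have h1 : M * Y = M + M * H * Y * A.transpose := by
    nth_rewrite 1 [hY]; noncomm_ring
  rw [h1, frobInner_add_left, h, frobInner_add_right, frobInner_mul_right (M * H * Y),
    Matrix.transpose_transpose, ← hHY, Matrix.mul_assoc M H Y]
  ring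

/-- Telescoping form of the control Riccati equation. -/
theorem frobInner_control_telescope {P : Matrix (Fin n) (Fin n) ℝ}
    (hP : P = 1 + A.transpose * P * (A + B * K))
    (hK : K = -(B.transpose * P * (A + B * K))) {r δ δ' : Matrix (Fin n) (Fin n) ℝ}
    {μ : Matrix (Fin m) (Fin n) ℝ} (h : δ' = A * δ + B * μ) :
    frobInner r δ + frobInner (K * r) μ =
      frobInner (P * r) δ - frobInner (P * ((A + B * K) * r)) δ' := by
  have h1 : P * r = r + A.transpose * (P * ((A + B * K) * r)) := by
    nth_rewrite 1 [hP]; noncomm_ring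
  have h2 : K * r = -(B.transpose * (P * ((A + B * K) * r))) := by
    nth_rewrite 1 [hK]; simp only [Matrix.neg_mul, Matrix.mul_assoc]
  rw [h1, h2, frobInner_add_left, frobInner_neg_left, h, frobInner_add_right,
    frobInner_mul_left A.transpose, frobInner_mul_left B.transpose, Matrix.transpose_transpose,
    Matrix.transpose_transpose]
  ring

/-- Inner product of the coefficients of `z⁻ᵗ`. -/
def SystemResponse.innerAt {l : ℕ} (Φ Δ : SystemResponse n m l) (t : ℕ) : ℝ :=
  frobInner (Φ.xw t) (Δ.xw t) + frobInner (Φ.xe t) (Δ.xe t) + frobInner (Φ.uw t) (Δ.uw t) +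
    frobInner (Φ.ue t) (Δ.ue t)

theorem SystemResponse.hasSum_innerAt {l : ℕ} {Φ Δ : SystemResponse n m l} {s : ℝ}
    (h : HasSum (fun i => Φ.coeff i * Δ.coeff i) s) : HasSum (Φ.innerAt Δ) s := by
  refine h.prod_fiberwise fun t => ?_
  have h1 := hasSum_fintype fun p => Φ.coeff (t, p) * Δ.coeff (t, p)
  convert h1 using 1
  simp only [innerAt, frobInner, Fintype.sum_sum_type, Fintype.sum_prod_type, coeff, add_assoc]

/-- The partial inner product with a feasible direction is a boundary term, which vanishes in the
limit when all responses tend to zero. -/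
theorem observerResponse_innerAt_sum {P Y : Matrix (Fin n) (Fin n) ℝ}
    (hP : P = 1 + A.transpose * P * (A + B * K))
    (hK : K = -(B.transpose * P * (A + B * K)))
    (hY : Y = 1 + H * Y * A.transpose) (hHY : H * Y = A - H)
    {Δ : SystemResponse n m n} (h0w : Δ.xw 0 = 0) (h0e : Δ.xe 0 = 0) (h0u : Δ.uw 0 = 0)
    (h0v : Δ.ue 0 = 0)
    (hrw : ∀ k, Δ.xw (k + 1) = A * Δ.xw k + B * Δ.uw k)
    (hre : ∀ k, Δ.xe (k + 1) = A * Δ.xe k + B * Δ.ue k)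
    (hcx : ∀ k, Δ.xw (k + 1) = Δ.xw k * A + Δ.xe k) (T : ℕ) :
    ∑ t ∈ Finset.range (T + 1), (observerResponse A B K H).innerAt Δ t =
      -(frobInner (H ^ T * Y) (Δ.xw (T + 1)) +
        frobInner (P * estimateResponse A B K H T) (Δ.xw (T + 1)) +
        frobInner (P * estimateErrorResponse A B K H T) (Δ.xe (T + 1)) +
        frobInner (P * (A - H) * H ^ T * Y) (Δ.xw (T + 2))) := by
  have hw1 : Δ.xw 1 = 0 := by rw [hrw 0, h0w, h0u]; simp
  have he1 : Δ.xe 1 = 0 := by rw [hre 0, h0e, h0v]; simp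
  have hw2 : Δ.xw 2 = 0 := by rw [hcx 1, hw1, he1]; simp
  induction T with
  | zero =>
    simp [SystemResponse.innerAt, h0w, h0e, h0u, h0v, hw1, he1, hw2, frobInner]
  | succ T ih =>
    rw [Finset.sum_range_succ, ih]
    have e1 := frobInner_filter_telescope hY hHY (H ^ T) (hcx (T + 1))
    -- The observer drives the estimate, so the control telescopes `e3` and `e4` leave terms with `P
    -- * (A - H) * H ^ T`. Together they form the left side of a second filter telescope.
    have e2 := frobInner_filter_telescope hY hHY (P * (A - H) * H ^ T) (hcx (T + 2))
    have e3 := frobInner_control_telescope hP hK (r := estimateResponse A B K H T) (hrw (T + 1))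
    have e4 := frobInner_control_telescope hP hK (r := estimateErrorResponse A B K H T)
      (hre (T + 1))
    have f1 : (A + B * K) * estimateResponse A B K H T =
        estimateResponse A B K H (T + 1) - (A - H) * H ^ T := by
      simp [estimateResponse]
    have f2 : (A + B * K) * estimateErrorResponse A B K H T =
        estimateErrorResponse A B K H (T + 1) + (A - H) * H ^ T * (A - H) := by
      rw [estimateErrorResponse_succ]; abel
    rw [f1, Matrix.mul_sub, frobInner_sub_left, ← Matrix.mul_assoc P (A - H)] at e3
    rw [f2, Matrix.mul_add, frobInner_add_left, ← Matrix.mul_assoc P, ← Matrix.mul_assoc P] at e4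
    have e5 : (observerResponse A B K H).innerAt Δ (T + 1) =
        frobInner (H ^ T) (Δ.xw (T + 1)) +
          frobInner (estimateResponse A B K H T) (Δ.xw (T + 1)) +
        (frobInner (estimateErrorResponse A B K H T) (Δ.xe (T + 1)) -
          frobInner (H ^ T * (A - H)) (Δ.xe (T + 1))) +
        frobInner (K * estimateResponse A B K H T) (Δ.uw (T + 1)) +
        frobInner (K * estimateErrorResponse A B K H T) (Δ.ue (T + 1)) := by
      simp only [SystemResponse.innerAt, observerResponse, frobInner_add_left, frobInner_sub_left]
    rw [e5, pow_succ, ← Matrix.mul_assoc (P * (A - H)) (H ^ T) H]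
    linarith

/-- Observer based feedback built from solutions of both Riccati equations is `H₂` optimal. -/
theorem observerResponse_isH2Optimal {P Y : Matrix (Fin n) (Fin n) ℝ}
    (hP : P = 1 + A.transpose * P * (A + B * K))
    (hK : K = -(B.transpose * P * (A + B * K)))
    (hY : Y = 1 + H * Y * A.transpose) (hHY : H * Y = A - H)
    (hH : Tendsto (fun k => H ^ k) atTop (𝓝 0))
    (hR : Tendsto (estimateResponse A B K H) atTop (𝓝 0))
    (hfin : (observerResponse A B K H).h2NormSq < ⊤) :
    IsH2Optimal A B 1 ⊤ (observerResponse A B K H) := by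
  refine isH2Optimal_of_orthogonal ⟨observerResponse_realizable, hfin, le_top⟩ fun Ψ hΨ s hs => ?_
  set Φ := observerResponse A B K H with hΦ
  have hr : Φ.Realizable A B 1 := observerResponse_realizable
  have hψ := hΨ.realizable
  set Δ : SystemResponse n m n := ⟨fun t => Ψ.xw t - Φ.xw t, fun t => Ψ.xe t - Φ.xe t,
    fun t => Ψ.uw t - Φ.uw t, fun t => Ψ.ue t - Φ.ue t⟩ with hΔ
  have hco : ∀ i, Δ.coeff i = Ψ.coeff i - Φ.coeff i := by
    rintro ⟨t, (p | p) | (p | p)⟩ <;> rfl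
  simp only [← hco] at hs
  have hs' := (SystemResponse.hasSum_innerAt hs).tendsto_sum_nat
  have hrw : ∀ k, Δ.xw (k + 1) = A * Δ.xw k + B * Δ.uw k := by
    intro k
    have := (hψ.row_w k).trans (hr.row_w k).symm
    simp only [hΔ, Matrix.mul_sub]
    rw [← sub_eq_zero] at this ⊢
    rw [← this]
    abel
  have hre : ∀ k, Δ.xe (k + 1) = A * Δ.xe k + B * Δ.ue k := by
    intro k
    have := (hψ.row_e k).trans (hr.row_e k).symm
    simp only [hΔ, Matrix.mul_sub]
    rw [← sub_eq_zero] at this ⊢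
    rw [← this]
    abel
  have hcx : ∀ k, Δ.xw (k + 1) = Δ.xw k * A + Δ.xe k := by
    intro k
    have := (hψ.col_x k).trans (hr.col_x k).symm
    simp only [Matrix.mul_one] at this
    simp only [hΔ, Matrix.sub_mul]
    rw [← sub_eq_zero] at this ⊢
    rw [← this]
    abel
  have hsum := observerResponse_innerAt_sum hP hK hY hHY (Δ := Δ)
    (by simp [hΔ, hψ.xw_zero, hr.xw_zero]) (by simp [hΔ, hψ.xe_zero, hr.xe_zero])
    (by simp [hΔ, hψ.uw_zero, hr.uw_zero]) (by simp [hΔ, hψ.ue_zero, hr.ue_zero]) hrw hre hcx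
  have hw : Tendsto Δ.xw atTop (𝓝 0) := by
    refine tendsto_pi_nhds.2 fun i => tendsto_pi_nhds.2 fun j => ?_
    have h1 := (SystemResponse.tendsto_coeff hΨ.finite_cost (.inl (.inl (i, j)))).sub
      (SystemResponse.tendsto_coeff hfin (.inl (.inl (i, j))))
    rw [sub_zero] at h1
    exact h1
  have he : Tendsto Δ.xe atTop (𝓝 0) := by
    refine tendsto_pi_nhds.2 fun i => tendsto_pi_nhds.2 fun j => ?_
    have h1 := (SystemResponse.tendsto_coeff hΨ.finite_cost (.inl (.inr (i, j)))).sub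
      (SystemResponse.tendsto_coeff hfin (.inl (.inr (i, j))))
    rw [sub_zero] at h1
    exact h1
  have hleft : ∀ (X : Matrix (Fin n) (Fin n) ℝ) {M : ℕ → Matrix (Fin n) (Fin n) ℝ},
      Tendsto M atTop (𝓝 0) → Tendsto (fun k => X * M k) atTop (𝓝 0) := fun X M hM => by
    simpa [Function.comp_def] using ((continuous_const (y := X)).matrix_mul continuous_id).continuousAt.tendsto.comp hM
  have hright : ∀ (X : Matrix (Fin n) (Fin n) ℝ) {M : ℕ → Matrix (Fin n) (Fin n) ℝ},
      Tendsto M atTop (𝓝 0) → Tendsto (fun k => M k * X) atTop (𝓝 0) := fun X M hM => by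
    simpa [Function.comp_def] using (continuous_id.matrix_mul (continuous_const (y := X))).continuousAt.tendsto.comp hM
  have hE : Tendsto (estimateErrorResponse A B K H) atTop (𝓝 0) := by
    have h1 := (hR.comp (tendsto_add_atTop_nat 1)).sub (hright A hR)
    rw [sub_zero] at h1
    exact h1
  have hlim : Tendsto (fun T => ∑ t ∈ Finset.range (T + 1), Φ.innerAt Δ t) atTop (𝓝 0) := by
    have h1 := tendsto_frobInner (hright Y hH) (hw.comp (tendsto_add_atTop_nat 1))
    have h2 := tendsto_frobInner (hleft P hR) (hw.comp (tendsto_add_atTop_nat 1))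
    have h3 := tendsto_frobInner (hleft P hE) (he.comp (tendsto_add_atTop_nat 1))
    have h4 := tendsto_frobInner (hright Y (hleft (P * (A - H)) hH))
      (hw.comp (tendsto_add_atTop_nat 2))
    have h5 := (((h1.add h2).add h3).add h4).neg
    simp only [add_zero, neg_zero] at h5
    exact h5.congr fun T => (hsum T).symm
  exact tendsto_nhds_unique (hs'.comp (tendsto_add_atTop_nat 1)) hlim

end Lqg

/-! ### Exponential decay, with a rate that leaves slack above `1 / 2` and above the row sums of
`H`. -/

section Decay

/-- Exponential decay at the rate `9 / 10`. -/
def ExpDecay (a : ℕ → ℝ) : Prop := ∃ C, ∀ k, |a k| ≤ C * (9 / 10 : ℝ) ^ k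

namespace ExpDecay

variable {a b : ℕ → ℝ}

theorem add (ha : ExpDecay a) (hb : ExpDecay b) : ExpDecay fun k => a k + b k := by
  obtain ⟨C, hC⟩ := ha
  obtain ⟨D, hD⟩ := hb
  refine ⟨C + D, fun k => (abs_add_le _ _).trans ?_⟩
  rw [add_mul]
  exact add_le_add (hC k) (hD k)

theorem const_mul (ha : ExpDecay a) (c : ℝ) : ExpDecay fun k => c * a k := by
  obtain ⟨C, hC⟩ := ha
  refine ⟨|c| * C, fun k => ?_⟩
  rw [abs_mul, mul_assoc]
  exact mul_le_mul_of_nonneg_left (hC k) (abs_nonneg _)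

theorem sub (ha : ExpDecay a) (hb : ExpDecay b) : ExpDecay fun k => a k - b k := by
  simpa [sub_eq_add_neg] using ha.add (hb.const_mul (-1))

theorem sum {ι : Type*} (s : Finset ι) {f : ι → ℕ → ℝ} (h : ∀ i, ExpDecay (f i)) :
    ExpDecay fun k => ∑ i ∈ s, f i k := by
  choose C hC using h
  refine ⟨∑ i ∈ s, C i, fun k => ?_⟩
  rw [Finset.sum_mul]
  exact (Finset.abs_sum_le_sum_abs _ _).trans (Finset.sum_le_sum fun i _ => hC i k)

theorem succ (ha : ExpDecay a) : ExpDecay fun k => a (k + 1) := by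
  obtain ⟨C, hC⟩ := ha
  refine ⟨C * (9 / 10), fun k => (hC (k + 1)).trans (le_of_eq ?_)⟩
  rw [pow_succ]; ring

theorem of_succ (ha : ExpDecay fun k => a (k + 1)) : ExpDecay a := by
  obtain ⟨C, hC⟩ := ha
  refine ⟨max |a 0| (C * (10 / 9)), fun k => ?_⟩
  cases k with
  | zero => simp
  | succ k =>
    refine (hC k).trans ?_
    have h1 : C * (9 / 10 : ℝ) ^ k = C * (10 / 9) * (9 / 10) ^ (k + 1) := by
      rw [pow_succ]; ring
    rw [h1]
    exact mul_le_mul_of_nonneg_right (le_max_right _ _) (by positivity)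

/-- A stable first order recursion preserves exponential decay. -/
theorem of_recursion (hb : ExpDecay b) (h : ∀ k, a (k + 1) = 1 / 2 * a k + b k) : ExpDecay a := by
  obtain ⟨C, hC⟩ := hb
  refine ⟨max |a 0| (5 / 2 * C), fun k => ?_⟩
  induction k with
  | zero => simp
  | succ k ih =>
    rw [h k]
    refine (abs_add_le _ _).trans ?_
    rw [abs_mul, abs_of_pos (by norm_num : (0 : ℝ) < 1 / 2), pow_succ]
    have h1 : C ≤ 2 / 5 * max |a 0| (5 / 2 * C) := by
      have := le_max_right |a 0| (5 / 2 * C)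
      linarith
    have h2 : C * (9 / 10 : ℝ) ^ k ≤ 2 / 5 * max |a 0| (5 / 2 * C) * (9 / 10) ^ k :=
      mul_le_mul_of_nonneg_right h1 (by positivity)
    have := hC k
    linarith

theorem summable_abs (ha : ExpDecay a) : Summable fun k => |a k| := by
  obtain ⟨C, hC⟩ := ha
  exact Summable.of_nonneg_of_le (fun _ => abs_nonneg _) hC
    ((summable_geometric_of_lt_one (by norm_num) (by norm_num)).mul_left C)

theorem summable (ha : ExpDecay a) : Summable a := ha.summable_abs.of_abs

theorem tendsto_zero (ha : ExpDecay a) : Tendsto a atTop (𝓝 0) := ha.summable.tendsto_atTop_zero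

theorem mul (ha : ExpDecay a) (hb : ExpDecay b) : ExpDecay fun k => a k * b k := by
  obtain ⟨C, hC⟩ := ha
  obtain ⟨D, hD⟩ := hb
  have hD0 : 0 ≤ D := by simpa using (abs_nonneg _).trans (hD 0)
  refine ⟨C * D, fun k => ?_⟩
  rw [abs_mul]
  have h1 : |b k| ≤ D := (hD k).trans (mul_le_of_le_one_right hD0
    (pow_le_one₀ (by norm_num) (by norm_num)))
  calc |a k| * |b k| ≤ (C * (9 / 10) ^ k) * D :=
        mul_le_mul (hC k) h1 (abs_nonneg _) ((abs_nonneg _).trans (hC k))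
    _ = C * D * (9 / 10) ^ k := by ring

theorem tail (ha : ExpDecay a) : ExpDecay fun k => ∑' s, a (s + (k + 1)) := by
  obtain ⟨C, hC⟩ := ha
  have hg : Summable fun s : ℕ => (9 / 10 : ℝ) ^ s :=
    summable_geometric_of_lt_one (by norm_num) (by norm_num)
  refine ⟨9 * C, fun k => ?_⟩
  have hb : ∀ s, ‖a (s + (k + 1))‖ ≤ C * (9 / 10) ^ (k + 1) * (9 / 10 : ℝ) ^ s := fun s => by
    refine (hC _).trans (le_of_eq ?_)
    rw [pow_add]; ring
  have h2 := tsum_of_norm_bounded ((hg.mul_left (C * (9 / 10) ^ (k + 1))).hasSum) hb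
  rw [tsum_mul_left, tsum_geometric_of_lt_one (by norm_num) (by norm_num)] at h2
  refine h2.trans (le_of_eq ?_)
  rw [pow_succ]; ring

end ExpDecay

/-- Entrywise exponential decay. -/
def MatrixDecay {a b : ℕ} (M : ℕ → Matrix (Fin a) (Fin b) ℝ) : Prop :=
  ∀ i j, ExpDecay fun k => M k i j

namespace MatrixDecay

variable {a b c : ℕ} {M N : ℕ → Matrix (Fin a) (Fin b) ℝ}

theorem add (hM : MatrixDecay M) (hN : MatrixDecay N) : MatrixDecay fun k => M k + N k :=
  fun i j => (hM i j).add (hN i j)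

theorem sub (hM : MatrixDecay M) (hN : MatrixDecay N) : MatrixDecay fun k => M k - N k :=
  fun i j => (hM i j).sub (hN i j)

theorem mul_left (hM : MatrixDecay M) (X : Matrix (Fin c) (Fin a) ℝ) :
    MatrixDecay fun k => X * M k := by
  intro i j
  simp only [Matrix.mul_apply]
  exact ExpDecay.sum _ fun p => (hM p j).const_mul _

theorem mul_right (hM : MatrixDecay M) (X : Matrix (Fin b) (Fin c) ℝ) :
    MatrixDecay fun k => M k * X := by
  intro i j
  simp only [Matrix.mul_apply, mul_comm (M _ _ _)]
  exact ExpDecay.sum _ fun p => (hM i p).const_mul _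

theorem tendsto_zero (hM : MatrixDecay M) : Tendsto M atTop (𝓝 0) :=
  tendsto_pi_nhds.2 fun i => tendsto_pi_nhds.2 fun j => (hM i j).tendsto_zero

theorem of_succ (hM : MatrixDecay fun k => M (k + 1)) : MatrixDecay M :=
  fun i j => (hM i j).of_succ

theorem pow {H : Matrix (Fin a) (Fin a) ℝ} (h : ∀ i, ∑ j, |H i j| ≤ 9 / 10) :
    MatrixDecay fun k => H ^ k := by
  intro i j
  suffices hb : ∀ k, |(H ^ k) i j| ≤ (9 / 10) ^ k from ⟨1, fun k => by rw [one_mul]; exact hb k⟩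
  intro k
  induction k generalizing i with
  | zero =>
    rw [pow_zero, pow_zero, Matrix.one_apply]
    split_ifs <;> simp
  | succ k ih =>
    rw [pow_succ', Matrix.mul_apply]
    calc |∑ p, H i p * (H ^ k) p j| ≤ ∑ p, |H i p| * (9 / 10) ^ k := by
          refine (Finset.abs_sum_le_sum_abs _ _).trans (Finset.sum_le_sum fun p _ => ?_)
          rw [abs_mul]
          exact mul_le_mul_of_nonneg_left (ih p) (abs_nonneg _)
      _ = (∑ p, |H i p|) * (9 / 10) ^ k := by rw [Finset.sum_mul]
      _ ≤ 9 / 10 * (9 / 10) ^ k := mul_le_mul_of_nonneg_right (h i) (by positivity)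
      _ = (9 / 10) ^ (k + 1) := by rw [pow_succ']

end MatrixDecay

theorem SystemResponse.h2NormSq_lt_top_of_decay {n m l : ℕ} {Φ : SystemResponse n m l}
    (h1 : MatrixDecay Φ.xw) (h2 : MatrixDecay Φ.xe) (h3 : MatrixDecay Φ.uw)
    (h4 : MatrixDecay Φ.ue) : Φ.h2NormSq < ⊤ := by
  have key : ∀ {a b : ℕ} {M : ℕ → Matrix (Fin a) (Fin b) ℝ}, MatrixDecay M →
      ∑' t, frobSq (M t) ≠ ⊤ := by
    intro a b M hM
    have hs : ExpDecay fun t => ∑ i, ∑ j, M t i j ^ 2 := by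
      simp only [sq]
      exact ExpDecay.sum _ fun i => ExpDecay.sum _ fun j => (hM i j).mul (hM i j)
    have : ∀ t, frobSq (M t) = ENNReal.ofReal (∑ i, ∑ j, M t i j ^ 2) := by
      intro t
      rw [ENNReal.ofReal_sum_of_nonneg (f := fun i => ∑ j, M t i j ^ 2)
        fun _ _ => Finset.sum_nonneg fun _ _ => sq_nonneg _, frobSq]
      refine Finset.sum_congr rfl fun i _ => ?_
      rw [ENNReal.ofReal_sum_of_nonneg fun _ _ => sq_nonneg _]
    simp only [this]
    exact hs.summable.tsum_ofReal_ne_top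
  rw [h2NormSq, ENNReal.tsum_add, ENNReal.tsum_add, ENNReal.tsum_add]
  exact ENNReal.add_lt_top.2 ⟨ENNReal.add_lt_top.2 ⟨ENNReal.add_lt_top.2
    ⟨(key h1).lt_top, (key h2).lt_top⟩, (key h3).lt_top⟩, (key h4).lt_top⟩

end Decay

/-! ### Scalar recursions for the error responses. -/

section ScalarRecursion

variable {s φ ψ : ℕ → ℝ} {t d : ℝ}

/-- Here `s` and `φ` are minus the position and minus the sum of position and velocity, `ψ` the
observer drive. Summing each recursion gives the static gain; `1 - t + d` is the characteristic
polynomial of `H` at one. -/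
theorem sum_of_recursions (hs : Summable s) (hφ : Summable φ) (hψ : Summable ψ)
    (hs0 : s 0 = 0) (hφ0 : φ 0 = 0) (hs1 : ∀ k, s (k + 1) = 1 / 2 * s k + 1 / 2 * φ k)
    (hφ1 : ∀ k, φ (k + 1) = 1 / 2 * φ k + ψ k)
    (hψ2 : ∀ k, ψ (k + 2) = t * ψ (k + 1) - d * ψ k) :
    ∑' k, s k = ∑' k, φ k ∧ (1 - t + d) * ∑' k, s k = 2 * (ψ 0 * (1 - t) + ψ 1) := by
  have e1 : ∑' k, s k = 1 / 2 * ∑' k, s k + 1 / 2 * ∑' k, φ k := by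
    rw [← tsum_mul_left, ← tsum_mul_left, ← (hs.mul_left _).tsum_add (hφ.mul_left _),
      hs.tsum_eq_zero_add, hs0, zero_add]
    exact tsum_congr hs1
  have e2 : ∑' k, φ k = 1 / 2 * ∑' k, φ k + ∑' k, ψ k := by
    rw [← tsum_mul_left, ← (hφ.mul_left _).tsum_add hψ, hφ.tsum_eq_zero_add, hφ0, zero_add]
    exact tsum_congr hφ1
  have hψ' : Summable fun k => ψ (k + 1) := (summable_nat_add_iff 1).2 hψ
  have e3 : ∑' k, ψ (k + 2) = t * ∑' k, ψ (k + 1) - d * ∑' k, ψ k := by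
    rw [← tsum_mul_left, ← tsum_mul_left, ← (hψ'.mul_left _).tsum_sub (hψ.mul_left _)]
    exact tsum_congr hψ2
  have e4 := hψ.tsum_eq_zero_add
  have e5 : ∑' k, ψ (k + 1) = ψ 1 + ∑' k, ψ (k + 2) := hψ'.tsum_eq_zero_add
  have e6 : ∑' k, s k = ∑' k, φ k := by linarith
  refine ⟨e6, ?_⟩
  have e7 : ∑' k, s k = 2 * ∑' k, ψ k := by linarith
  rw [e7]
  linear_combination (2 : ℝ) * (e5 + e3) + 2 * (1 - t) * e4

/-- A quadratic cone that is invariant under the recursions. -/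
theorem nonneg_of_cone {w : ℝ} (hw : 0 < w) (hd : d = t ^ 2 / 4 + w) (hd' : d ≤ 9 / 64)
    (hs1 : ∀ k, s (k + 1) = 1 / 2 * s k + 1 / 2 * φ k)
    (hφ1 : ∀ k, φ (k + 1) = 1 / 2 * φ k + ψ k)
    (hψ2 : ∀ k, ψ (k + 2) = t * ψ (k + 1) - d * ψ k) {k₀ : ℕ} (h0 : 0 ≤ φ k₀) (h1 : φ k₀ ≤ s k₀)
    (h2 : (ψ (k₀ + 1) - t / 2 * ψ k₀) ^ 2 + w * ψ k₀ ^ 2 ≤ w * (φ k₀ / 8) ^ 2) (k : ℕ)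
    (hk : k₀ ≤ k) : 0 ≤ φ k ∧ φ k ≤ s k := by
  -- The quadratic form on the left is multiplied by exactly `d` in each step, while `φ` shrinks at
  -- most by `1 / 2 - 1 / 8 = 3 / 8`. As `d ≤ (3 / 8) ^ 2`, the inequality persists.
  suffices h : 0 ≤ φ k ∧ φ k ≤ s k ∧
      (ψ (k + 1) - t / 2 * ψ k) ^ 2 + w * ψ k ^ 2 ≤ w * (φ k / 8) ^ 2 from ⟨h.1, h.2.1⟩
  induction k, hk using Nat.le_induction with
  | base => exact ⟨h0, h1, h2⟩
  | succ k _ ih =>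
    obtain ⟨i0, i1, i2⟩ := ih
    have hψ : |ψ k| ≤ φ k / 8 := by
      apply abs_le_of_sq_le_sq _ (by positivity)
      have : w * ψ k ^ 2 ≤ w * (φ k / 8) ^ 2 := by
        nlinarith [sq_nonneg (ψ (k + 1) - t / 2 * ψ k)]
      exact le_of_mul_le_mul_left this hw
    rw [abs_le] at hψ
    have j0 : 3 / 8 * φ k ≤ φ (k + 1) := by rw [hφ1]; linarith [hψ.1]
    refine ⟨by linarith, by rw [hφ1, hs1]; linarith [hψ.2], ?_⟩
    have e : (ψ (k + 1 + 1) - t / 2 * ψ (k + 1)) ^ 2 + w * ψ (k + 1) ^ 2 =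
        d * ((ψ (k + 1) - t / 2 * ψ k) ^ 2 + w * ψ k ^ 2) := by
      rw [show k + 1 + 1 = k + 2 from rfl, hψ2, hd]; ring
    rw [e]
    have hdn : 0 ≤ d := by rw [hd]; positivity
    have j1 : (3 / 8 * φ k) ^ 2 ≤ φ (k + 1) ^ 2 := pow_le_pow_left₀ (by linarith) j0 2
    calc d * ((ψ (k + 1) - t / 2 * ψ k) ^ 2 + w * ψ k ^ 2) ≤ d * (w * (φ k / 8) ^ 2) :=
          mul_le_mul_of_nonneg_left i2 hdn
      _ ≤ 9 / 64 * (w * (φ k / 8) ^ 2) := mul_le_mul_of_nonneg_right hd' (by positivity)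
      _ = w / 64 * (3 / 8 * φ k) ^ 2 := by ring
      _ ≤ w / 64 * φ (k + 1) ^ 2 := mul_le_mul_of_nonneg_left j1 (by positivity)
      _ = w * (φ (k + 1) / 8) ^ 2 := by ring

/-- Because `t + d` is about `0.86`, inherited errors contract, leaving room for the rounding of
`t`, `d` and `r₀`. The same tolerance thus serves at every step. -/
theorem recursion_step_bound {p q r p₀ q₀ r₀ : ℝ} (ht : |t - 0.723154456| ≤ 3 / 10 ^ 7)
    (hd : |d - 0.137042945| ≤ 3 / 10 ^ 7) (hp : |p - p₀| ≤ 1 / 10 ^ 5) (hq : |q - q₀| ≤ 1 / 10 ^ 5)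
    (hp₀ : |p₀| ≤ 1 - 1 / 10 ^ 5) (hq₀ : |q₀| ≤ 1 - 1 / 10 ^ 5) (hr : r = t * q - d * p)
    (hr₀ : |0.723154456 * q₀ - 0.137042945 * p₀ - r₀| ≤ 5 / 10 ^ 7) : |r - r₀| ≤ 1 / 10 ^ 5 := by
  have hp1 : |p| ≤ 1 := by
    have := abs_add_le (p - p₀) p₀; rw [sub_add_cancel] at this; linarith
  have hq1 : |q| ≤ 1 := by
    have := abs_add_le (q - q₀) q₀; rw [sub_add_cancel] at this; linarith
  have h1 : |(t - 0.723154456) * q| ≤ 3 / 10 ^ 7 := by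
    rw [abs_mul]
    exact (mul_le_of_le_one_right (abs_nonneg _) hq1).trans ht
  have h2 : |(d - 0.137042945) * p| ≤ 3 / 10 ^ 7 := by
    rw [abs_mul]
    exact (mul_le_of_le_one_right (abs_nonneg _) hp1).trans hd
  rw [hr]
  rw [abs_le] at *
  constructor <;> nlinarith

end ScalarRecursion

/-! ### Signs of the two error responses. -/

section Columns

variable {s φ ψ : ℕ → ℝ} {t d : ℝ}

theorem nonneg_of_steps (hs1 : ∀ k, s (k + 1) = 1 / 2 * s k + 1 / 2 * φ k) (hs0 : s 0 = 0)
    {k₀ : ℕ} (h : ∀ k < k₀, 0 ≤ φ k) (h' : ∀ k, k₀ ≤ k → 0 ≤ φ k ∧ φ k ≤ s k) (k : ℕ) :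
    0 ≤ s k := by
  have hφ : ∀ k, 0 ≤ φ k := fun k => (lt_or_ge k k₀).elim (h k) fun hk => (h' k hk).1
  induction k with
  | zero => rw [hs0]
  | succ k ih => rw [hs1]; linarith [hφ k]

theorem cone_of_bounds {w c c' f X Y w₀ w₁ Z : ℝ} (hc : |c' - t / 2 * c| ≤ X) (hY : |c| ≤ Y)
    (hw₀ : w₀ ≤ w) (hw₁ : w ≤ w₁) (hw : 0 ≤ w₀) (hZ : 0 ≤ Z) (hf : Z ≤ f)
    (h : X ^ 2 + w₁ * Y ^ 2 ≤ w₀ * (Z / 8) ^ 2) :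
    (c' - t / 2 * c) ^ 2 + w * c ^ 2 ≤ w * (f / 8) ^ 2 := by
  have h1 : (c' - t / 2 * c) ^ 2 ≤ X ^ 2 := by
    rw [← sq_abs]; exact pow_le_pow_left₀ (abs_nonneg _) hc 2
  have h2 : c ^ 2 ≤ Y ^ 2 := by rw [← sq_abs]; exact pow_le_pow_left₀ (abs_nonneg _) hY 2
  have h3 : w * c ^ 2 ≤ w₁ * Y ^ 2 := mul_le_mul hw₁ h2 (sq_nonneg _) (hw.trans (hw₀.trans hw₁))
  have h4 : w₀ * (Z / 8) ^ 2 ≤ w * (f / 8) ^ 2 :=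
    mul_le_mul hw₀ (pow_le_pow_left₀ (by positivity) (by linarith) 2) (sq_nonneg _)
      (hw.trans hw₀)
  linarith

/-- The positive value means that the eigenvalues of `H` are not real: `ψ` oscillates, and a cone is
needed to control signs. -/
theorem discriminant_bounds (ht : |t - 0.723154456| ≤ 3 / 10 ^ 7)
    (hd : |d - 0.137042945| ≤ 3 / 10 ^ 7) :
    0.0063 ≤ d - t ^ 2 / 4 ∧ d - t ^ 2 / 4 ≤ 0.00631 := by
  rw [abs_le] at *
  constructor <;> nlinarith

/-- Signs of the response to the error in the position measurement. -/
theorem position_column_signs (ht : |t - 0.723154456| ≤ 3 / 10 ^ 7)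
    (hd : |d - 0.137042945| ≤ 3 / 10 ^ 7) (hs0 : s 0 = 0) (hφ0 : φ 0 = 0)
    (hs1 : ∀ k, s (k + 1) = 1 / 2 * s k + 1 / 2 * φ k)
    (hφ1 : ∀ k, φ (k + 1) = 1 / 2 * φ k + ψ k)
    (hψ2 : ∀ k, ψ (k + 2) = t * ψ (k + 1) - d * ψ k)
    (h0 : |ψ 0 - 0.38171437| ≤ 1 / 10 ^ 5) (h1 : |ψ 1 - 0.10126832| ≤ 1 / 10 ^ 5) :
    (∀ k, 0 ≤ s k) ∧ ∀ k, 3 ≤ k → φ k ≤ s k := by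
  have h2 : |ψ 2 - 0.0209214| ≤ 1 / 10 ^ 5 := recursion_step_bound ht hd h0 h1
    (by norm_num [abs_le]) (by norm_num [abs_le]) (hψ2 0) (by norm_num [abs_le])
  have h3 : |ψ 3 - 0.0012513| ≤ 1 / 10 ^ 5 := recursion_step_bound ht hd h1 h2
    (by norm_num [abs_le]) (by norm_num [abs_le]) (hψ2 1) (by norm_num [abs_le])
  have h4 : |ψ 4 - -0.0019622| ≤ 1 / 10 ^ 5 := recursion_step_bound ht hd h2 h3
    (by norm_num [abs_le]) (by norm_num [abs_le]) (hψ2 2) (by norm_num [abs_le])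
  have h5 : |ψ 5 - -0.0015905| ≤ 1 / 10 ^ 5 := recursion_step_bound ht hd h3 h4
    (by norm_num [abs_le]) (by norm_num [abs_le]) (hψ2 3) (by norm_num [abs_le])
  have h6 : |ψ 6 - -0.0008813| ≤ 1 / 10 ^ 5 := recursion_step_bound ht hd h4 h5
    (by norm_num [abs_le]) (by norm_num [abs_le]) (hψ2 4) (by norm_num [abs_le])
  obtain ⟨hw₀, hw₁⟩ := discriminant_bounds ht hd
  have hχ : |ψ 6 - t / 2 * ψ 5| ≤ 0.00033 := by
    rw [abs_le] at *
    constructor <;> nlinarith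
  have hψ5 : |ψ 5| ≤ 0.00161 := by rw [abs_le] at *; constructor <;> linarith
  rw [abs_le] at h0 h1 h2 h3 h4
  have f1 : φ 1 = ψ 0 := by rw [hφ1, hφ0]; ring
  have f2 : φ 2 = 1 / 2 * φ 1 + ψ 1 := hφ1 1
  have f3 : φ 3 = 1 / 2 * φ 2 + ψ 2 := hφ1 2
  have f4 : φ 4 = 1 / 2 * φ 3 + ψ 3 := hφ1 3
  have f5 : φ 5 = 1 / 2 * φ 4 + ψ 4 := hφ1 4
  have s1 : s 1 = 0 := by rw [hs1, hs0, hφ0]; ring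
  have s2 : s 2 = 1 / 2 * s 1 + 1 / 2 * φ 1 := hs1 1
  have s3 : s 3 = 1 / 2 * s 2 + 1 / 2 * φ 2 := hs1 2
  have s4 : s 4 = 1 / 2 * s 3 + 1 / 2 * φ 3 := hs1 3
  have s5 : s 5 = 1 / 2 * s 4 + 1 / 2 * φ 4 := hs1 4
  -- The cone condition is verified at index `5`; `0.0403` is a lower bound for `φ 5`. Earlier terms
  -- are checked one by one.
  have hcone := nonneg_of_cone (t := t) (d := d) (w := d - t ^ 2 / 4) (k₀ := 5) (by linarith)
    (by ring) (by rw [abs_le] at hd; linarith) hs1 hφ1 hψ2 (by linarith) (by linarith)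
    (cone_of_bounds hχ hψ5 hw₀ hw₁ (by norm_num) (Z := 0.0403) (by norm_num) (by linarith)
      (by norm_num))
  refine ⟨nonneg_of_steps hs1 hs0 (k₀ := 5) (fun k hk => ?_) hcone, fun k hk => ?_⟩
  · interval_cases k <;> linarith
  · rcases lt_or_ge k 5 with hk5 | hk5
    · interval_cases k <;> linarith
    · exact (hcone k hk5).2

/-- Signs of the response to the error in the velocity measurement. -/
theorem velocity_column_signs (ht : |t - 0.723154456| ≤ 3 / 10 ^ 7)
    (hd : |d - 0.137042945| ≤ 3 / 10 ^ 7) (hs0 : s 0 = 0) (hφ0 : φ 0 = 0)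
    (hs1 : ∀ k, s (k + 1) = 1 / 2 * s k + 1 / 2 * φ k)
    (hφ1 : ∀ k, φ (k + 1) = 1 / 2 * φ k + ψ k)
    (hψ2 : ∀ k, ψ (k + 2) = t * ψ (k + 1) - d * ψ k)
    (h0 : |ψ 0 - 0.78716042| ≤ 1 / 10 ^ 5) (h1 : |ψ 1 - 0.32432084| ≤ 1 / 10 ^ 5) :
    (∀ k, 0 ≤ s k) ∧ ∀ k, 3 ≤ k → φ k ≤ s k := by
  have h2 : |ψ 2 - 0.1266593| ≤ 1 / 10 ^ 5 := recursion_step_bound ht hd h0 h1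
    (by norm_num [abs_le]) (by norm_num [abs_le]) (hψ2 0) (by norm_num [abs_le])
  have h3 : |ψ 3 - 0.0471484| ≤ 1 / 10 ^ 5 := recursion_step_bound ht hd h1 h2
    (by norm_num [abs_le]) (by norm_num [abs_le]) (hψ2 1) (by norm_num [abs_le])
  have h4 : |ψ 4 - 0.0167378| ≤ 1 / 10 ^ 5 := recursion_step_bound ht hd h2 h3
    (by norm_num [abs_le]) (by norm_num [abs_le]) (hψ2 2) (by norm_num [abs_le])
  obtain ⟨hw₀, hw₁⟩ := discriminant_bounds ht hd
  have hχ : |ψ 4 - t / 2 * ψ 3| ≤ 0.00034 := by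
    rw [abs_le] at *
    constructor <;> nlinarith
  have hψ3 : |ψ 3| ≤ 0.0472 := by rw [abs_le] at *; constructor <;> linarith
  rw [abs_le] at h0 h1 h2
  have f1 : φ 1 = ψ 0 := by rw [hφ1, hφ0]; ring
  have f2 : φ 2 = 1 / 2 * φ 1 + ψ 1 := hφ1 1
  have f3 : φ 3 = 1 / 2 * φ 2 + ψ 2 := hφ1 2
  have s1 : s 1 = 0 := by rw [hs1, hs0, hφ0]; ring
  have s2 : s 2 = 1 / 2 * s 1 + 1 / 2 * φ 1 := hs1 1
  have s3 : s 3 = 1 / 2 * s 2 + 1 / 2 * φ 2 := hs1 2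
  have hcone := nonneg_of_cone (t := t) (d := d) (w := d - t ^ 2 / 4) (k₀ := 3) (by linarith)
    (by ring) (by rw [abs_le] at hd; linarith) hs1 hφ1 hψ2 (by linarith) (by linarith)
    (cone_of_bounds hχ hψ3 hw₀ hw₁ (by norm_num) (Z := 0.4854) (by norm_num) (by linarith)
      (by norm_num))
  refine ⟨nonneg_of_steps hs1 hs0 (k₀ := 3) (fun k hk => ?_) hcone, fun k hk => (hcone k hk).2⟩
  interval_cases k <;> linarith

/-- The velocity response changes sign once, and has zero sum. -/
theorem tsum_abs_velocity (hs : Summable s) (hφ : Summable φ) (hψ : Summable ψ)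
    (hs0 : s 0 = 0) (hφ0 : φ 0 = 0) (hs1 : ∀ k, s (k + 1) = 1 / 2 * s k + 1 / 2 * φ k)
    (hφ1 : ∀ k, φ (k + 1) = 1 / 2 * φ k + ψ k)
    (hψ2 : ∀ k, ψ (k + 2) = t * ψ (k + 1) - d * ψ k) (h0 : 0 ≤ ψ 0) (h1 : 0 ≤ ψ 1)
    (h : ∀ k, 3 ≤ k → φ k ≤ s k) : HasSum (fun k => |s k - φ k|) (2 * (ψ 0 + ψ 1)) := by
  have e := (sum_of_recursions hs hφ hψ hs0 hφ0 hs1 hφ1 hψ2).1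
  have e1 : HasSum (fun k => s k - φ k) 0 := by
    have := hs.hasSum.sub hφ.hasSum
    rwa [e, sub_self] at this
  -- Flipping the three initial terms of nonpositive sign turns the zero sum of `s - φ` into the sum
  -- of absolute values, which is twice their total size.
  have e2 : HasSum (fun k => if k ∈ Finset.range 3 then 2 * (φ k - s k) else 0)
      (∑ k ∈ Finset.range 3, if k ∈ Finset.range 3 then 2 * (φ k - s k) else 0) :=
    hasSum_sum_of_ne_finset_zero fun k hk => if_neg hk
  have f1 : φ 1 = ψ 0 := by rw [hφ1, hφ0]; ring
  have f2 : φ 2 = 1 / 2 * φ 1 + ψ 1 := hφ1 1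
  have s1 : s 1 = 0 := by rw [hs1, hs0, hφ0]; ring
  have s2 : s 2 = 1 / 2 * s 1 + 1 / 2 * φ 1 := hs1 1
  have e3 := e1.add e2
  convert e3 using 1
  · funext k
    split_ifs with hk
    · have hk' := Finset.mem_range.1 hk
      have : s k - φ k ≤ 0 := by interval_cases k <;> linarith
      rw [abs_of_nonpos this]; ring
    · have hk' : 3 ≤ k := by simpa using hk
      rw [abs_of_nonneg (by linarith [h k hk'])]; ring
  · simp [Finset.sum_range_succ]
    linarith

end Columns

/-! ### The LQG response of the double integrator. -/

section DoubleIntegrator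

/-- The optimal feedback gain of the double integrator. -/
noncomputable def doubleIntegratorK : Matrix (Fin 1) (Fin 2) ℝ := !![-1 / 2, -1]

/-- The solution of the control Riccati equation of the double integrator. -/
def doubleIntegratorP : Matrix (Fin 2) (Fin 2) ℝ := !![4, 2; 2, 3]

theorem doubleIntegrator_closedLoop :
    doubleIntegratorA 0.5 + doubleIntegratorB * doubleIntegratorK = !![1, 1 / 2; -1 / 2, 0] := by
  ext i j
  fin_cases i <;> fin_cases j <;>
    norm_num [doubleIntegratorA, doubleIntegratorB, doubleIntegratorK, Matrix.mul_apply]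

theorem doubleIntegratorA_transpose :
    (doubleIntegratorA 0.5).transpose = !![1, 0; 1 / 2, 1] := by
  ext i j
  fin_cases i <;> fin_cases j <;> norm_num [doubleIntegratorA]

theorem doubleIntegratorB_transpose : doubleIntegratorB.transpose = !![0, 1] := by
  ext i j
  fin_cases i; fin_cases j <;> norm_num [doubleIntegratorB]

theorem doubleIntegratorP_eq : doubleIntegratorP = 1 + (doubleIntegratorA 0.5).transpose *
    doubleIntegratorP * (doubleIntegratorA 0.5 + doubleIntegratorB * doubleIntegratorK) := by
  rw [doubleIntegrator_closedLoop, doubleIntegratorA_transpose, doubleIntegratorP,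
    Matrix.one_fin_two]
  ext i j
  fin_cases i <;> fin_cases j <;> norm_num [Matrix.mul_apply, Fin.sum_univ_two]

theorem doubleIntegratorK_eq : doubleIntegratorK = -(doubleIntegratorB.transpose *
    doubleIntegratorP * (doubleIntegratorA 0.5 + doubleIntegratorB * doubleIntegratorK)) := by
  rw [doubleIntegrator_closedLoop, doubleIntegratorB_transpose, doubleIntegratorP,
    doubleIntegratorK]
  ext i j
  fin_cases i; fin_cases j <;> norm_num [Matrix.mul_apply, Fin.sum_univ_two]

/-- Observer based feedback for the double integrator with the optimal gain. -/
noncomputable def doubleIntegratorResponse (H : Matrix (Fin 2) (Fin 2) ℝ) :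
    SystemResponse 2 1 2 :=
  observerResponse (doubleIntegratorA 0.5) doubleIntegratorB doubleIntegratorK H

variable {H : Matrix (Fin 2) (Fin 2) ℝ}

/-- The closed-loop matrix has the double eigenvalue `1 / 2` with left eigenvector `(1, 1)`. In the
coordinates position and sum it is triangular, so two scalar recursions suffice. -/
theorem estimateResponse_decay (hH : MatrixDecay fun k => H ^ k) :
    MatrixDecay (estimateResponse (doubleIntegratorA 0.5) doubleIntegratorB doubleIntegratorK H) := by
  set R := estimateResponse (doubleIntegratorA 0.5) doubleIntegratorB doubleIntegratorK H with hR
  have hg := hH.mul_left (doubleIntegratorA 0.5 - H)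
  have hrec : ∀ k, R (k + 1) = !![1, 1 / 2; -1 / 2, 0] * R k +
      (doubleIntegratorA 0.5 - H) * H ^ k := by
    intro k
    rw [hR, estimateResponse, doubleIntegrator_closedLoop]
  have h0 : ∀ k j, R (k + 1) 0 j = R k 0 j + 1 / 2 * R k 1 j +
      ((doubleIntegratorA 0.5 - H) * H ^ k) 0 j := by
    intro k j
    rw [hrec, Matrix.add_apply, Matrix.mul_apply, Fin.sum_univ_two]
    simp
  have h1 : ∀ k j, R (k + 1) 1 j = -1 / 2 * R k 0 j +
      ((doubleIntegratorA 0.5 - H) * H ^ k) 1 j := by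
    intro k j
    rw [hrec, Matrix.add_apply, Matrix.mul_apply, Fin.sum_univ_two]
    simp
  have hσ : ∀ j, ExpDecay fun k => R k 0 j + R k 1 j := fun j =>
    ExpDecay.of_recursion ((hg 0 j).add (hg 1 j)) fun k => by rw [h0, h1]; ring
  have hx : ∀ j, ExpDecay fun k => R k 0 j := fun j =>
    ExpDecay.of_recursion (((hσ j).const_mul (1 / 2)).add (hg 0 j)) fun k => by rw [h0]; ring
  intro i j
  fin_cases i
  · exact hx j
  · have := (hσ j).sub (hx j)
    simpa using this

theorem doubleIntegratorResponse_decay (hH : MatrixDecay fun k => H ^ k) :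
    MatrixDecay (doubleIntegratorResponse H).xw ∧ MatrixDecay (doubleIntegratorResponse H).xe ∧
      MatrixDecay (doubleIntegratorResponse H).uw ∧
      MatrixDecay (doubleIntegratorResponse H).ue := by
  have hR := estimateResponse_decay hH
  have hE : MatrixDecay (estimateErrorResponse (doubleIntegratorA 0.5) doubleIntegratorB
      doubleIntegratorK H) :=
    MatrixDecay.sub (fun i j => (hR i j).succ) (hR.mul_right _)
  exact ⟨MatrixDecay.of_succ (hH.add hR), MatrixDecay.of_succ (hE.sub (hH.mul_right _)),
    MatrixDecay.of_succ (hR.mul_left _), MatrixDecay.of_succ (hE.mul_left _)⟩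

theorem doubleIntegratorResponse_isH2Optimal {Y : Matrix (Fin 2) (Fin 2) ℝ}
    (hY : Y = 1 + H * Y * (doubleIntegratorA 0.5).transpose)
    (hHY : H * Y = doubleIntegratorA 0.5 - H) (hH : MatrixDecay fun k => H ^ k) :
    IsH2Optimal (doubleIntegratorA 0.5) doubleIntegratorB 1 ⊤ (doubleIntegratorResponse H) := by
  obtain ⟨h1, h2, h3, h4⟩ := doubleIntegratorResponse_decay hH
  exact observerResponse_isH2Optimal doubleIntegratorP_eq doubleIntegratorK_eq hY hHY
    hH.tendsto_zero (estimateResponse_decay hH).tendsto_zero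
    (SystemResponse.h2NormSq_lt_top_of_decay h1 h2 h3 h4)

/-- Response of the negative input to the estimation error caused by a measurement error. -/
noncomputable def innovationDrive (H : Matrix (Fin 2) (Fin 2) ℝ) (j : Fin 2) (k : ℕ) : ℝ :=
  1 / 2 * (H ^ k * (doubleIntegratorA 0.5 - H)) 0 j + (H ^ k * (doubleIntegratorA 0.5 - H)) 1 j

theorem doubleIntegratorResponse_xe_succ (k : ℕ) (j : Fin 2) :
    (doubleIntegratorResponse H).xe (k + 2) 0 j = (doubleIntegratorResponse H).xe (k + 1) 0 j +
        1 / 2 * (doubleIntegratorResponse H).xe (k + 1) 1 j ∧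
      (doubleIntegratorResponse H).xe (k + 2) 1 j =
        -1 / 2 * (doubleIntegratorResponse H).xe (k + 1) 0 j - innovationDrive H j k := by
  have h : (doubleIntegratorResponse H).xe (k + 2) =
      !![1, 1 / 2; -1 / 2, 0] * (doubleIntegratorResponse H).xe (k + 1) +
        !![0, 0; -1 / 2, -1] * (H ^ k * (doubleIntegratorA 0.5 - H)) := by
    have hBK : !![0, 0; -1 / 2, -1] = doubleIntegratorB * doubleIntegratorK := by
      ext i j
      fin_cases i <;> fin_cases j <;>
        norm_num [doubleIntegratorB, doubleIntegratorK, Matrix.mul_apply]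
    rw [hBK, ← doubleIntegrator_closedLoop]
    simp only [doubleIntegratorResponse, observerResponse, estimateErrorResponse_succ]
    rw [pow_succ']
    noncomm_ring
  constructor <;> rw [h, Matrix.add_apply, Matrix.mul_apply, Matrix.mul_apply, Fin.sum_univ_two,
    Fin.sum_univ_two] <;> simp [innovationDrive]
  ring

/-- Cayley–Hamilton for `H`. -/
theorem innovationDrive_succ (j : Fin 2) (k : ℕ) : innovationDrive H j (k + 2) =
    (H 0 0 + H 1 1) * innovationDrive H j (k + 1) -
      (H 0 0 * H 1 1 - H 0 1 * H 1 0) * innovationDrive H j k := by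
  have h : H * H = (H 0 0 + H 1 1) • H - (H 0 0 * H 1 1 - H 0 1 * H 1 0) • (1 : Matrix _ _ ℝ) := by
    ext i j
    fin_cases i <;> fin_cases j <;> simp [Matrix.mul_apply, Fin.sum_univ_two] <;> ring
  have h1 : H ^ (k + 2) = (H 0 0 + H 1 1) • H ^ (k + 1) -
      (H 0 0 * H 1 1 - H 0 1 * H 1 0) • H ^ k := by
    rw [pow_add, pow_two, h, pow_succ]
    simp [Matrix.mul_sub]
  simp only [innovationDrive, h1, Matrix.sub_mul, Matrix.smul_mul, Matrix.sub_apply,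
    Matrix.smul_apply, smul_eq_mul]
  ring

end DoubleIntegrator

theorem tsum_row_eq_ofReal {a b : ℕ} {F : ℕ → Matrix (Fin a) (Fin b) ℝ} {i : Fin a} {v : ℝ}
    (hF : F 0 = 0) (h : HasSum (fun k => ∑ j, |F (k + 1) i j|) v) :
    ∑' t, ∑ j, ENNReal.ofReal |F t i j| = ENNReal.ofReal v := by
  have h1 : HasSum (fun t => ∑ j, |F t i j|) v := by
    rw [← hasSum_nat_add_iff' 1]
    simpa [hF] using h
  rw [← h1.tsum_eq, ENNReal.ofReal_tsum_of_nonneg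
    (fun _ => Finset.sum_nonneg fun _ _ => abs_nonneg _) h1.summable]
  refine tsum_congr fun t => ?_
  rw [ENNReal.ofReal_sum_of_nonneg fun _ _ => abs_nonneg _]

/-- With the error `-S x₁ (1, 1)`, where `1 / S` is the static gain of the position response, the
loop has a pole at one. -/
theorem not_asymptoticallyStable_of_static_gain {Φ : SystemResponse 2 1 2}
    (h : Φ.Realizable (doubleIntegratorA 0.5) doubleIntegratorB 1) (hw : MatrixDecay Φ.xw)
    (he : MatrixDecay Φ.xe) {S : ℝ} (hS : S ≠ 0)
    (hsum : HasSum (fun t => -(Φ.xe t 0 0 + Φ.xe t 0 1)) (1 / S))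
    (hv : ∑' t, Φ.xe t 0 1 ≠ 0) :
    ¬ ClosedLoopAsymptoticallyStable (doubleIntegratorA 0.5) doubleIntegratorB 1 Φ
      fun x _ => -S * x 0 := by
  rintro ⟨-, hattr⟩
  obtain ⟨δ, hδ, hatt⟩ := hattr 0
  obtain ⟨x, y, u, ht⟩ := h.exists_trajectory (fun x _ => -S * x 0) 0 ![δ / 2, 0]
  have hx := (hatt 0 ![δ / 2, 0] x y u ht (fun k hk => absurd hk (Nat.not_lt_zero k)) (by
    rw [pi_norm_lt_iff hδ]
    intro i
    fin_cases i
    · simpa [abs_of_pos hδ] using hδ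
    · simpa using hδ)).1
  have ha : Tendsto (fun k => x k 0) atTop (𝓝 0) := tendsto_pi_nhds.1 hx 0
  set p : ℕ → ℝ := fun t => -S * (Φ.xe t 0 0 + Φ.xe t 0 1) with hp
  have hpd : ExpDecay p := ((he 0 0).add (he 0 1)).const_mul _
  have hp1 : HasSum p 1 := by
    have h1 := hsum.mul_left S
    rw [mul_one_div_cancel hS] at h1
    refine h1.congr_fun ?_
    intro t
    simp only [hp]; ring
  have hp0 : p 0 = 0 := by simp [hp, h.xe_zero]
  have hcol : ∀ k, Φ.xw (k + 2) 0 1 =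
      1 / 2 * Φ.xw (k + 1) 0 0 + Φ.xw (k + 1) 0 1 + Φ.xe (k + 1) 0 1 := by
    intro k
    have h1 := h.col_x (k + 1)
    rw [if_neg (Nat.succ_ne_zero k), Matrix.mul_one, sub_sub, sub_eq_zero] at h1
    rw [h1, Matrix.add_apply, Matrix.mul_apply, Fin.sum_univ_two]
    simp [doubleIntegratorA]
    ring
  have s00 := (hw 0 0).succ.summable
  have s01 := (hw 0 1).succ.summable
  have se := (he 0 1).succ.summable
  -- Summing `hcol` cancels the sums of `Φ.xw · 0 1`, since that entry vanishes at time one. The sum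
  -- of the forcing term is thus tied to the static gain from the velocity error.
  have hX : ∑' k, Φ.xw (k + 1) 0 0 = -2 * ∑' t, Φ.xe t 0 1 := by
    have e1 : ∑' k, Φ.xw (k + 1) 0 1 = 1 / 2 * ∑' k, Φ.xw (k + 1) 0 0 +
        ∑' k, Φ.xw (k + 1) 0 1 + ∑' k, Φ.xe (k + 1) 0 1 := by
      rw [← tsum_mul_left, ← (s00.mul_left _).tsum_add s01,
        ← ((s00.mul_left _).add s01).tsum_add se, s01.tsum_eq_zero_add, zero_add, h.xw_one]
      rw [Matrix.one_apply_ne (by decide), zero_add]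
      exact tsum_congr hcol
    have e2 := (he 0 1).summable.tsum_eq_zero_add
    rw [h.xe_zero] at e2
    simp only [Matrix.zero_apply, zero_add] at e2
    linarith
  have hg : HasSum (fun k => Φ.xw (k + 1) 0 0 * (δ / 2)) ((∑' k, Φ.xw (k + 1) 0 0) * (δ / 2)) :=
    s00.hasSum.mul_right _
  have hren : ∀ k, x k 0 = Φ.xw (k + 1) 0 0 * (δ / 2) +
      ∑ t ∈ Finset.range (k + 1), p t * x (k - t) 0 := by
    intro k
    have h1 := congrFun (h.trajectory_eq ht k) 0
    rw [h1]
    simp only [causalConv, Pi.add_apply, Finset.sum_apply, Matrix.mulVec, dotProduct,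
      Fin.sum_univ_two]
    simp only [Matrix.cons_val_zero, Matrix.cons_val_one, mul_zero, add_zero, hp]
    congr 1
    refine Finset.sum_congr rfl fun t _ => ?_
    ring
  have htail : ∀ k, ∑' s, p (s + (k + 1)) = 1 - ∑ i ∈ Finset.range (k + 1), p i := by
    intro k
    rw [eq_sub_iff_add_eq', ← hp1.tsum_eq]
    exact hp1.summable.sum_add_tsum_nat_add (k + 1)
  -- The tails of `p` start at one because `p` has mass one and `p 0 = 0`.
  have hG := renewal_sum_eq_zero (τ := fun k => ∑' s, p (s + (k + 1))) hp0
    (by rw [htail]; simp [hp0])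
    (fun k => by
      rw [htail, htail, Finset.sum_range_succ _ (k + 1)]; ring)
    hpd.tail.summable_abs hg hren ha
  rw [hX] at hG
  rcases mul_eq_zero.1 hG with hG | hG
  · exact hv (by linarith)
  · linarith

/-! ### Numerical value of the gain. -/

section Gain

/-- The numbers `0.41388` and `0.4139` enclose `1 - t + d`, and `0.276845544` approximates `1 - t`;
the slack `1 / 10 ^ 4` absorbs all other errors. -/
theorem static_gain_bounds {t d p q p₀ q₀ x l u : ℝ} (ht : |t - 0.723154456| ≤ 3 / 10 ^ 7)
    (hd : |d - 0.137042945| ≤ 3 / 10 ^ 7) (hp : |p - p₀| ≤ 1 / 10 ^ 5) (hq : |q - q₀| ≤ 1 / 10 ^ 5)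
    (hp₀ : |p₀| ≤ 1) (h : (1 - t + d) * x = 2 * (p * (1 - t) + q)) (hl0 : 0 ≤ l) (hu0 : 0 ≤ u)
    (hl : l * 0.4139 ≤ 2 * (p₀ * 0.276845544 + q₀) - 1 / 10 ^ 4)
    (hu : 2 * (p₀ * 0.276845544 + q₀) + 1 / 10 ^ 4 ≤ u * 0.41388) : l ≤ x ∧ x ≤ u := by
  have h1 : |(p - p₀) * (1 - t)| ≤ 1 / 10 ^ 5 := by
    rw [abs_mul]
    refine (mul_le_of_le_one_right (abs_nonneg _) ?_).trans hp
    rw [abs_le] at *; constructor <;> linarith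
  have h2 : |p₀ * (t - 0.723154456)| ≤ 3 / 10 ^ 7 := by
    rw [abs_mul]
    exact (mul_le_of_le_one_left (abs_nonneg _) hp₀).trans ht
  rw [abs_le] at ht hd hq h1 h2
  have hN : p * (1 - t) + q = p₀ * 0.276845544 + q₀ + (p - p₀) * (1 - t) -
      p₀ * (t - 0.723154456) + (q - q₀) := by ring
  have hD : 0 < 1 - t + d := by linarith
  constructor
  · refine le_of_mul_le_mul_left ?_ hD
    have : l * (1 - t + d) ≤ l * 0.4139 := mul_le_mul_of_nonneg_left (by linarith) hl0
    linarith
  · refine le_of_mul_le_mul_left ?_ hD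
    have : u * 0.41388 ≤ u * (1 - t + d) := mul_le_mul_of_nonneg_left (by linarith) hu0
    linarith

variable {H : Matrix (Fin 2) (Fin 2) ℝ}

/-- Negative of the position response to the `j`-th measurement error. -/
noncomputable def positionSignal (H : Matrix (Fin 2) (Fin 2) ℝ) (j : Fin 2) (k : ℕ) : ℝ :=
  -(doubleIntegratorResponse H).xe (k + 1) 0 j

/-- Negative of the sum of position and velocity response to the `j`-th measurement error. -/
noncomputable def sumSignal (H : Matrix (Fin 2) (Fin 2) ℝ) (j : Fin 2) (k : ℕ) : ℝ :=
  -((doubleIntegratorResponse H).xe (k + 1) 0 j + (doubleIntegratorResponse H).xe (k + 1) 1 j)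

theorem doubleIntegratorResponse_realizable :
    (doubleIntegratorResponse H).Realizable (doubleIntegratorA 0.5) doubleIntegratorB 1 :=
  observerResponse_realizable

theorem positionSignal_zero (j : Fin 2) : positionSignal H j 0 = 0 := by
  simp [positionSignal, doubleIntegratorResponse_realizable.xe_one]

theorem sumSignal_zero (j : Fin 2) : sumSignal H j 0 = 0 := by
  simp [sumSignal, doubleIntegratorResponse_realizable.xe_one]

theorem positionSignal_succ (j : Fin 2) (k : ℕ) :
    positionSignal H j (k + 1) = 1 / 2 * positionSignal H j k + 1 / 2 * sumSignal H j k := by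
  simp only [positionSignal, sumSignal, (doubleIntegratorResponse_xe_succ k j).1]
  ring

theorem sumSignal_succ (j : Fin 2) (k : ℕ) :
    sumSignal H j (k + 1) = 1 / 2 * sumSignal H j k + innovationDrive H j k := by
  simp only [sumSignal, (doubleIntegratorResponse_xe_succ k j).1,
    (doubleIntegratorResponse_xe_succ k j).2]
  ring

/-- Gains of the optimal response, from bounds for the error state matrix. -/
theorem doubleIntegratorResponse_gain (ha : |H 0 0 - 0.333497535| ≤ 1 / 10 ^ 7)
    (hb : |H 0 1 - 0.146365323| ≤ 1 / 10 ^ 7) (hc : |H 1 0 + 0.048463138| ≤ 1 / 10 ^ 7)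
    (he : |H 1 1 - 0.389656921| ≤ 1 / 10 ^ 7) (hH : MatrixDecay fun k => H ^ k) :
    ∃ V, 3.6167 ≤ V ∧ V ≤ 3.6297 ∧
      HasSum (fun t => -((doubleIntegratorResponse H).xe t 0 0 +
        (doubleIntegratorResponse H).xe t 0 1)) V ∧
      ∑' t, (doubleIntegratorResponse H).xe t 0 1 ≠ 0 ∧
      l1SystemNorm (doubleIntegratorResponse H).xe = ENNReal.ofReal V := by
  have hdec := (doubleIntegratorResponse_decay hH).2.1
  have hx0 := (doubleIntegratorResponse_realizable (H := H)).xe_zero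
  have ht : |H 0 0 + H 1 1 - 0.723154456| ≤ 3 / 10 ^ 7 := by
    rw [abs_le] at *; constructor <;> linarith
  have hd : |H 0 0 * H 1 1 - H 0 1 * H 1 0 - 0.137042945| ≤ 3 / 10 ^ 7 := by
    rw [abs_le] at *; constructor <;> nlinarith
  have p00 : innovationDrive H 0 0 = 1 / 2 * (1 - H 0 0) - H 1 0 := by
    simp [innovationDrive, doubleIntegratorA]; ring
  have p10 : innovationDrive H 1 0 = 1 / 2 * (1 / 2 - H 0 1) + (1 - H 1 1) := by
    simp [innovationDrive, doubleIntegratorA]; ring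
  have p01 : innovationDrive H 0 1 = 1 / 2 * (H 0 0 * (1 - H 0 0) - H 0 1 * H 1 0) +
      (H 1 0 * (1 - H 0 0) - H 1 1 * H 1 0) := by
    simp [innovationDrive, doubleIntegratorA, Matrix.mul_apply, Fin.sum_univ_two]; ring
  have p11 : innovationDrive H 1 1 = 1 / 2 * (H 0 0 * (1 / 2 - H 0 1) + H 0 1 * (1 - H 1 1)) +
      (H 1 0 * (1 / 2 - H 0 1) + H 1 1 * (1 - H 1 1)) := by
    simp [innovationDrive, doubleIntegratorA, Matrix.mul_apply, Fin.sum_univ_two]; ring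
  have q00 : |innovationDrive H 0 0 - 0.38171437| ≤ 1 / 10 ^ 5 := by
    rw [p00]; rw [abs_le] at *; constructor <;> linarith
  have q10 : |innovationDrive H 1 0 - 0.78716042| ≤ 1 / 10 ^ 5 := by
    rw [p10]; rw [abs_le] at *; constructor <;> linarith
  have q01 : |innovationDrive H 0 1 - 0.10126832| ≤ 1 / 10 ^ 5 := by
    rw [p01]; rw [abs_le] at ha hb hc he ⊢; constructor <;> nlinarith
  have q11 : |innovationDrive H 1 1 - 0.32432084| ≤ 1 / 10 ^ 5 := by
    rw [p11]; rw [abs_le] at ha hb hc he ⊢; constructor <;> nlinarith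
  obtain ⟨n0, m0⟩ := position_column_signs ht hd (positionSignal_zero 0) (sumSignal_zero 0)
    (positionSignal_succ 0) (sumSignal_succ 0) (innovationDrive_succ 0) q00 q01
  obtain ⟨n1, m1⟩ := velocity_column_signs ht hd (positionSignal_zero 1) (sumSignal_zero 1)
    (positionSignal_succ 1) (sumSignal_succ 1) (innovationDrive_succ 1) q10 q11
  have ss : ∀ j, Summable (positionSignal H j) := fun j => (hdec 0 j).succ.summable.neg
  have sφ : ∀ j, Summable (sumSignal H j) := fun j =>
    ((hdec 0 j).succ.add (hdec 1 j).succ).summable.neg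
  have sψ : ∀ j, Summable (innovationDrive H j) := fun j =>
    ((((hH.mul_right _) 0 j).const_mul (1 / 2)).add ((hH.mul_right _) 1 j)).summable
  have g : ∀ j, _ := fun j => (sum_of_recursions (ss j) (sφ j) (sψ j) (positionSignal_zero j)
    (sumSignal_zero j) (positionSignal_succ j) (sumSignal_succ j) (innovationDrive_succ j)).2
  have g0 := g 0
  have g1 := g 1
  have v0 := static_gain_bounds ht hd q00 q01 (by norm_num [abs_le]) g0
    (l := 0.999) (u := 1.001) (by norm_num) (by norm_num) (by norm_num) (by norm_num)
  have v1 := static_gain_bounds ht hd q10 q11 (by norm_num [abs_le]) g1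
    (l := 2.619) (u := 2.622) (by norm_num) (by norm_num) (by norm_num) (by norm_num)
  rw [abs_le] at ht hd q00 q01 q10 q11
  have r0 := tsum_abs_velocity (ss 0) (sφ 0) (sψ 0) (positionSignal_zero 0)
    (sumSignal_zero 0) (positionSignal_succ 0) (sumSignal_succ 0) (innovationDrive_succ 0)
    (by linarith) (by linarith) m0
  have r1 := tsum_abs_velocity (ss 1) (sφ 1) (sψ 1) (positionSignal_zero 1)
    (sumSignal_zero 1) (positionSignal_succ 1) (sumSignal_succ 1) (innovationDrive_succ 1)
    (by linarith) (by linarith) m1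
  have hsum := (ss 0).hasSum.add (ss 1).hasSum
  refine ⟨∑' k, positionSignal H 0 k + ∑' k, positionSignal H 1 k, by linarith, by linarith,
    ?_, ?_, ?_⟩
  · rw [← hasSum_nat_add_iff' 1]
    simp only [Finset.sum_range_one, hx0, Matrix.zero_apply, add_zero, neg_zero, sub_zero]
    refine hsum.congr_fun fun k => ?_
    simp only [positionSignal]; ring
  · have e1 : ∑' t, (doubleIntegratorResponse H).xe t 0 1 = -∑' k, positionSignal H 1 k := by
      rw [(hdec 0 1).summable.tsum_eq_zero_add, hx0, ← tsum_neg]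
      simp [positionSignal]
    rw [e1]
    intro h0
    linarith
  · have row0 : HasSum (fun k => ∑ j, |(doubleIntegratorResponse H).xe (k + 1) 0 j|)
        (∑' k, positionSignal H 0 k + ∑' k, positionSignal H 1 k) := by
      refine hsum.congr_fun fun k => ?_
      rw [Fin.sum_univ_two, ← abs_neg, ← abs_neg ((doubleIntegratorResponse H).xe (k + 1) 0 1)]
      exact congrArg₂ _ (abs_of_nonneg (n0 k)) (abs_of_nonneg (n1 k))
    have row1 : HasSum (fun k => ∑ j, |(doubleIntegratorResponse H).xe (k + 1) 1 j|)
        (2 * (innovationDrive H 0 0 + innovationDrive H 0 1) +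
          2 * (innovationDrive H 1 0 + innovationDrive H 1 1)) := by
      refine (r0.add r1).congr_fun fun k => ?_
      rw [Fin.sum_univ_two]
      simp only [positionSignal, sumSignal]
      congr 2 <;> ring
    refine le_antisymm (iSup_le fun i => ?_) ?_
    · fin_cases i
      · exact (tsum_row_eq_ofReal hx0 row0).le
      · refine (tsum_row_eq_ofReal hx0 row1).le.trans (ENNReal.ofReal_le_ofReal ?_)
        -- The velocity row sums to about `3.19`, below the position row, about `3.62`.
        linarith
    · rw [← tsum_row_eq_ofReal hx0 row0]
      exact le_iSup (fun i => ∑' t, ∑ j, ENNReal.ofReal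
        |(doubleIntegratorResponse H).xe t i j|) 0

end Gain

/-! ### The main theorem. -/

theorem mainTheorem7 :
    ∃ S : ℝ, |S - 0.276| < 0.0005 ∧
      (∃ Φ : SystemResponse 2 1 2,
        IsH2Optimal (doubleIntegratorA 0.5) doubleIntegratorB 1 ⊤ Φ ∧
          l1SystemNorm Φ.xe = ENNReal.ofReal (1 / S)) ∧
      ∃ e : (Fin 2 → ℝ) → Fin 2 → ℝ,
        e 0 = 0 ∧ SlopeBoundedAbout S e 0 ∧
        ∀ α : ℝ,
          (∃ Φ : SystemResponse 2 1 2,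
            IsFeasible (doubleIntegratorA 0.5) doubleIntegratorB 1 (ENNReal.ofReal α) Φ) →
          ∃ Φ : SystemResponse 2 1 2,
            IsH2Optimal (doubleIntegratorA 0.5) doubleIntegratorB 1 (ENNReal.ofReal α) Φ ∧
            (∀ Ψ : SystemResponse 2 1 2,
              IsH2Optimal (doubleIntegratorA 0.5) doubleIntegratorB 1 (ENNReal.ofReal α) Ψ →
                Ψ = Φ) ∧
            (ClosedLoopAsymptoticallyStable (doubleIntegratorA 0.5) doubleIntegratorB 1 Φ e ↔
              α < 1 / S) := by
  obtain ⟨H, Y, hY, hHY, ha, hb, hc, he⟩ := exists_filter_riccati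
  have hH : MatrixDecay fun k => H ^ k := by
    refine MatrixDecay.pow fun i => ?_
    rw [abs_le] at ha hb hc he
    have h00 : |H 0 0| ≤ 2 / 5 := by rw [abs_le]; constructor <;> linarith
    have h01 : |H 0 1| ≤ 2 / 5 := by rw [abs_le]; constructor <;> linarith
    have h10 : |H 1 0| ≤ 2 / 5 := by rw [abs_le]; constructor <;> linarith
    have h11 : |H 1 1| ≤ 2 / 5 := by rw [abs_le]; constructor <;> linarith
    rw [Fin.sum_univ_two]
    fin_cases i
    · exact (add_le_add h00 h01).trans (by norm_num)
    · exact (add_le_add h10 h11).trans (by norm_num)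
  obtain ⟨V, hV1, hV2, hsum, hv, hl1⟩ := doubleIntegratorResponse_gain ha hb hc he hH
  have hopt := doubleIntegratorResponse_isH2Optimal hY hHY hH
  obtain ⟨dxw, dxe, -, -⟩ := doubleIntegratorResponse_decay hH
  have hVp : 0 < V := by linarith
  have hVV : 1 / (1 / V) = V := one_div_one_div V
  refine ⟨1 / V, ?_, ⟨doubleIntegratorResponse H, hopt, by rw [hVV, hl1]⟩,
    fun x _ => -(1 / V) * x 0, ?_, ?_, ?_⟩
  -- The bounds on `V` lie just inside `1 / 0.2765` and `1 / 0.2755`.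
  · have h1 : 1 / 3.6297 ≤ 1 / V := one_div_le_one_div_of_le hVp hV2
    have h2 : 1 / V ≤ 1 / 3.6167 := one_div_le_one_div_of_le (by norm_num) hV1
    norm_num at h1 h2 ⊢
    rw [abs_lt]
    constructor <;> linarith
  · funext i; simp
  · intro x
    have hp : 0 ≤ 1 / V := by positivity
    rw [pi_norm_le_iff_of_nonneg (by positivity)]
    intro i
    simp only [Pi.zero_apply, Pi.sub_apply, mul_zero, sub_zero]
    rw [norm_mul, norm_neg, Real.norm_of_nonneg hp]
    exact mul_le_mul_of_nonneg_left (norm_le_pi_norm x 0) hp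
  · intro α hfeas
    obtain ⟨Φ, hΦ, huniq⟩ := exists_unique_isH2Optimal hfeas
    refine ⟨Φ, hΦ, huniq, ?_⟩
    rw [hVV]
    constructor
    · intro hstab
      by_contra hα
      have hfe : IsFeasible (doubleIntegratorA 0.5) doubleIntegratorB 1 (ENNReal.ofReal α)
          (doubleIntegratorResponse H) :=
        ⟨hopt.1.realizable, hopt.1.finite_cost,
          hl1.le.trans (ENNReal.ofReal_le_ofReal (not_lt.1 hα))⟩
      -- For `α ≥ V` the constraint does not exclude the unconstrained optimum, which therefore is
      -- the unique constrained one.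
      have heq := huniq (doubleIntegratorResponse H) ⟨hfe, fun Ψ hΨ =>
        hopt.2 Ψ ⟨hΨ.realizable, hΨ.finite_cost, le_top⟩⟩
      rw [← heq] at hstab
      exact not_asymptoticallyStable_of_static_gain hopt.1.realizable dxw dxe
        (one_div_pos.2 hVp).ne' (by rw [hVV]; exact hsum) hv hstab
    · intro hα
      -- `ENNReal.ofReal` sends negative `α` to zero, so `max α 0` is the effective bound; it is
      -- still below `V`.
      have hl : l1SystemNorm Φ.xe ≤ ENNReal.ofReal (max α 0) :=
        hΦ.1.norm_le.trans (ENNReal.ofReal_le_ofReal (le_max_left _ _))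
      have hlt : max α 0 * (1 / V) < 1 := by
        rw [mul_one_div, div_lt_one hVp]
        exact max_lt hα hVp
      refine hΦ.1.realizable.closedLoop_asymptoticallyStable hΦ.1.finite_cost (le_max_right _ _)
        hl (by positivity) hlt (fun x => ?_) (D := doubleIntegratorB.transpose) ?_
      · have hp : 0 ≤ 1 / V := by positivity
        rw [pi_norm_le_iff_of_nonneg (by positivity)]
        intro i
        rw [norm_mul, norm_neg, Real.norm_of_nonneg hp]
        exact mul_le_mul_of_nonneg_left (norm_le_pi_norm x 0) hp
      · rw [doubleIntegratorB_transpose]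
        ext i j
        fin_cases i; fin_cases j
        simp [doubleIntegratorB, Matrix.mul_apply, Fin.sum_univ_two]
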